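/- **Theorem 3.4.** *Setting.* Let $P_1,\dots,P_n$ ($n\ge 1$) be independent random variables and let $\mathcal A=\{A_1,\dots,A_m\}$ be a finite collection of (bad) events, each determined by $P_1,\dots,P_n$. For an event $B$ let $\mathrm{vbl}(B)$ be the smallest set of variables that determines it, and let $\Gamma(B)$ be the set of all $A\in\mathcal A$ with $A\ne B$ and $\mathrm{vbl}(A)\cap \mathrm{vbl}(B)\neq\emptyset$. An assignment of values to the variables is *good* if no event of $\mathcal A$ holds in it. Let $\varepsilon\in(0,1)$ and $x:\mathcal A\to(0,1-\varepsilon)$ be such that $$\Pr[A]^{1-\varepsilon}\le x(A)\prod_{B\in\Gamma(A)}(1-x(B))\qquad\text{for all }A\in\mathcal A,$$ put $\delta=\min_{A\in\mathcal A}x(A)\prod_{B\in\Gamma(A)}(1-x(B))$, and suppose that $\log(1/\delta)\le q(n)$, where $q$ is a fixed polynomial (with coefficients in $\mathbb N$). For $p>0$ let $\mathcal A_p=\{A\in\mathcal A:\Pr[A]\ge p\}$ be the *core* at threshold $p$. (1) For every polynomial $s$ there is a polynomial $r$ such that for all $p\ge 1/s(n)$ (where $s(n)>0$) the core $\mathcal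 A_p$ has at most $r(n)$ elements. (2) For every $c>0$ there are constants $C,D>0$ such that the following holds for every $p$ with $0<p\le n^{-D/\varepsilon}$ (in particular for the inverse polynomial $p=n^{-D/\varepsilon}$, when $\varepsilon$ is fixed). Suppose that the core $\mathcal A_p$ is verifiable in time $\tau$: we have a procedure that, given any assignment, finds in at most $\tau$ steps an event of $\mathcal A_p$ that holds or detects that there is none (efficient verifiability means $\tau\le\mathrm{poly}(n)$). Run the Moser–Tardos algorithm on $\mathcal A_p$ alone: draw an initial assignment, then repeatedly ask the procedure for an event of $\mathcal A_p$ that holds and draw new independent values for the variables in its $\mathrm{vbl}$; return the current assignment as soon as there is no such event, and give up when one more resampling would be needed after $\lfloor R\rfloor$ resamplings, where $$R=C\,\frac{n}{\varepsilon^2}\log\frac{n}{\varepsilon^2}.$$ This algorithm always stops after at most $R$ resamplings and at most $(R+1)(n+\tau)$ steps (a call of the procedure counts with its running time, drawing a value of one variable counts as one step), and with probability at least $1-n^{-c}$ it returns an assignment that is good for all of $\mathcal A$. The polynomial $r$ and the constants $C,D$ depend only on $q$, $s$, $c$ ($r$ not on $n$, $\varepsilon$, $p$, the variables, the events or $x$;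 $C,D$ neither on these nor on $s$). -/

import Mathlib

open MeasureTheory

noncomputable section

namespace LLL

universe u v

variable {n : ℕ} {Ω : Fin n → Type u}

/-! An assignment to the `n` variables is a point `ω : ∀ k, Ω k`; an event is a set of assignments.
The variables are independent, variable `k` with law `μ k`, so that the joint law is the product
measure `Measure.pi μ`. A finite collection of bad events is a family `A : ι → Set (∀ k, Ω k)`. -/

/-- Whether `B` holds depends only on the values of the variables in `S`. -/
def DeterminedBy (B : Set (∀ k, Ω k)) (S : Set (Fin n)) : Prop :=
  ∀ ω ω' : ∀ k, Ω k, (∀ k ∈ S, ω k = ω' k) → (ω ∈ B ↔ ω' ∈ B)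

/-- The smallest set of variables by which `B` is determined (see `isLeast_vbl`). -/
def vbl (B : Set (∀ k, Ω k)) : Set (Fin n) :=
  ⋂₀ {S | DeterminedBy B S}

theorem DeterminedBy.inter {B : Set (∀ k, Ω k)} {S T : Set (Fin n)}
    (hS : DeterminedBy B S) (hT : DeterminedBy B T) : DeterminedBy B (S ∩ T) := by
  classical
  intro ω ω' h
  let η : ∀ k, Ω k := fun k => if k ∈ S then ω k else ω' k
  have h1 : ω ∈ B ↔ η ∈ B := hS ω η (fun k hk => by simp [η, hk])
  have h2 : η ∈ B ↔ ω' ∈ B := hT η ω' (fun k hk => by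
    by_cases hkS : k ∈ S
    · simp [η, hkS, h k ⟨hkS, hk⟩]
    · simp [η, hkS])
  exact h1.trans h2

theorem isLeast_vbl (B : Set (∀ k, Ω k)) : IsLeast {S | DeterminedBy B S} (vbl B) := by
  refine ⟨?_, fun S hS => Set.sInter_subset_of_mem hS⟩
  have hfin : {S : Set (Fin n) | DeterminedBy B S}.Finite := Set.toFinite _
  have key : ∀ F : Set (Set (Fin n)), F.Finite → (∀ S ∈ F, DeterminedBy B S) →
      DeterminedBy B (⋂₀ F) := by
    intro F hF
    induction F, hF using Set.Finite.induction_on with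
    | empty =>
      intro _ ω ω' h
      have : ω = ω' := funext fun k => h k (by simp)
      rw [this]
    | insert _ _ ih =>
      intro h
      rw [Set.sInter_insert]
      exact (h _ (Set.mem_insert _ _)).inter (ih fun S hS => h S (Set.mem_insert_of_mem _ hS))
  exact key _ hfin fun S hS => hS

/-- The neighbourhood `Γ(A i)`: the other bad events that share a variable with `A i`. -/
def nbhd {ι : Type v} [Fintype ι] (A : ι → Set (∀ k, Ω k)) (i : ι) : Finset ι :=
  open Classical in Finset.univ.filter fun j => j ≠ i ∧ (vbl (A j) ∩ vbl (A i)).Nonempty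

/-- `x(A i) * ∏_{B ∈ Γ(A i)} (1 - x(B))`. -/
def lllBound {ι : Type v} [Fintype ι] (A : ι → Set (∀ k, Ω k)) (x : ι → ℝ) (i : ι) : ℝ :=
  x i * ∏ j ∈ nbhd A i, (1 - x j)

/-- `δ`, the minimum of `x(A i) * ∏_{B ∈ Γ(A i)} (1 - x(B))` over the (finitely many) bad events. -/
def delta {ι : Type v} [Fintype ι] (A : ι → Set (∀ k, Ω k)) (x : ι → ℝ) : ℝ :=
  ⨅ i, lllBound A x i

/-- The probability of an event under a random choice of the independent variables. -/
def prob [∀ k, MeasurableSpace (Ω k)] (μ : ∀ k, Measure (Ω k)) (B : Set (∀ k, Ω k)) : ℝ :=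
  (Measure.pi μ).real B

/-- The local lemma condition with exponential `ε`-slack, with weights `x : ι → (0, 1 - ε)`. -/
structure ExpSlack [∀ k, MeasurableSpace (Ω k)] {ι : Type v} [Fintype ι]
    (μ : ∀ k, Measure (Ω k)) (A : ι → Set (∀ k, Ω k)) (ε : ℝ) (x : ι → ℝ) : Prop where
  pos : ∀ i, 0 < x i
  lt : ∀ i, x i < 1 - ε
  bound : ∀ i, prob μ (A i) ^ (1 - ε) ≤ lllBound A x i

/-- The core at threshold `p`: the bad events of probability at least `p`. -/
def core [∀ k, MeasurableSpace (Ω k)] {ι : Type v} [Fintype ι]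
    (μ : ∀ k, Measure (Ω k)) (A : ι → Set (∀ k, Ω k)) (p : ℝ) : Finset ι :=
  open Classical in Finset.univ.filter fun i => p ≤ prob μ (A i)

/-- A verification procedure for the events with index in `S`: given an arbitrary assignment, it
finds one of these events that holds, or detects that there is none; the event found depends
measurably on the assignment (automatic for discrete variables). `cost ω` is the number of
steps that the procedure takes on the assignment `ω`, in whatever machine model it is
implemented. -/
structure Verifier [∀ k, MeasurableSpace (Ω k)] {ι : Type v}
    (A : ι → Set (∀ k, Ω k)) (S : Finset ι) where
  find : (∀ k, Ω k) → Option ι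
  cost : (∀ k, Ω k) → ℕ
  mem_of_find : ∀ ω i, find ω = some i → i ∈ S ∧ ω ∈ A i
  notMem_of_find : ∀ ω, find ω = none → ∀ i ∈ S, ω ∉ A i
  measurable_find : ∀ i, MeasurableSet {ω | find ω = some i}

/-- Replace the values of the variables in `S` by those of the fresh sample `η`. -/
def resample (S : Set (Fin n)) (ω η : ∀ k, Ω k) : ∀ k, Ω k :=
  open Classical in fun k => if k ∈ S then η k else ω k

/-- What an execution leaves behind: the returned assignment (`none` if the execution gave up), the
number of resamplings, and the number of steps. -/
structure Outcome (Ω : Fin n → Type u) where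
  result : Option (∀ k, Ω k)
  resamplings : ℕ
  steps : ℕ

/-- The Moser-Tardos loop on the events in `S`, started in `ω` and with `K` resamplings left:
ask the verification procedure for an event in `S` that holds; if there is none, return the current
assignment; otherwise resample the variables of the event found, or give up if no resampling is
left. The samples `ξ t, ξ (t + 1), …` are fresh, and each of them is used in one resampling only.
A call of the procedure is charged its cost, and drawing a value of one variable is one step. -/
def mtLoop [∀ k, MeasurableSpace (Ω k)] {ι : Type v} {A : ι → Set (∀ k, Ω k)} {S : Finset ι}
    (V : Verifier A S) (ξ : ℕ → ∀ k, Ω k) : ℕ → ℕ → (∀ k, Ω k) → Outcome Ω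
  | 0, _, ω =>
    match V.find ω with
    | none => ⟨some ω, 0, V.cost ω⟩
    | some _ => ⟨none, 0, V.cost ω⟩
  | K + 1, t, ω =>
    match V.find ω with
    | none => ⟨some ω, 0, V.cost ω⟩
    | some i =>
      let rest := mtLoop V ξ K (t + 1) (resample (vbl (A i)) ω (ξ t))
      ⟨rest.result, rest.resamplings + 1, V.cost ω + (vbl (A i)).ncard + rest.steps⟩

/-- The Moser-Tardos algorithm on the events in `S`, stopped after at most `K` resamplings: draw an
initial assignment (`n` steps), then run the loop. -/
def moserTardos [∀ k, MeasurableSpace (Ω k)] {ι : Type v} {A : ι → Set (∀ k, Ω k)} {S : Finset ι}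
    (V : Verifier A S) (K : ℕ) (ξ : ℕ → ∀ k, Ω k) : Outcome Ω :=
  let run := mtLoop V ξ K 1 (ξ 0)
  ⟨run.result, run.resamplings, n + run.steps⟩

/-- The law of the algorithm's randomness: independent samples `ξ 0, ξ 1, …`, each of them drawn
from the joint law of the variables. -/
def sampleLaw [∀ k, MeasurableSpace (Ω k)] (μ : ∀ k, Measure (Ω k))
    [∀ k, IsProbabilityMeasure (μ k)] : Measure (ℕ → ∀ k, Ω k) :=
  Measure.infinitePi fun _ : ℕ => Measure.pi μ

/-- A good assignment: no bad event holds (in the core or outside). -/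
def Good {ι : Type v} (A : ι → Set (∀ k, Ω k)) (ω : ∀ k, Ω k) : Prop :=
  ∀ i, ω ∉ A i

/-- `C (n / ε²) log (n / ε²)`. -/
def resamplingBound (C : ℝ) (n : ℕ) (ε : ℝ) : ℝ :=
  C * ((n : ℝ) / ε ^ 2) * Real.log ((n : ℝ) / ε ^ 2)

end LLL

end

/-! The proof replaces witness trees by a supermartingale on assignments. A layering is a stack of
layers of variable-disjoint events in which every event shares a variable with the layer before it,
and the first layer with a root `R`. It records the part of an execution that can influence `R`,
latest resamplings first. A layering acts on a function `h` as an operator: the events must hold,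
then their variables are redrawn. `potential` is the sum of the resulting functions over all
layerings.

Putting one more resampling in front of an execution corresponds to `insertEvent`, which applies one
more operator from outside (`layersOp_insertEvent`) and loses no information
(`pushEvent_injective`). Hence resampling an event that holds sends the terms of the potential, in
expectation, injectively into terms of the potential. So the potential does not increase, and it
gains a factor `lam` whenever the event meets the root (`mul_refresh_potential_le`). Under the
product law the term of a layering integrates to the product of all `lam * Pr[A i]`, times the
integral of `h` (`lintegral_layersOp`). The local lemma condition with weights `x / (1 - x)` bounds
the sum of these products (`tsum_layersWeight_le`).

This is used twice. With root `vbl B`, `h` the indicator of `B` and `lam = 1`, it bounds the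
probability of returning an assignment in `B`. For a bad event outside the core the slack turns this
bound into `x i * p ^ ε`. Events with a common variable are neighbours of each other, so `δ`
controls the sum of their weights, and the total weight of the events that have variables is
polynomial; this also bounds the size of the core. With root `{k}`, `h = 1` and `lam = exp (ε ^ 2)`,
which the slack permits, it bounds the probability of giving up: among `n * m` resamplings some
variable is redrawn `m` times, and each time gains a factor `lam`. -/

open scoped ENNReal

namespace LLL

universe u v

/-! ### Resampling a set of variables under the product law. -/

section Resample

variable {n : ℕ} {Ω : Fin n → Type u}

theorem resample_apply_of_mem {S : Set (Fin n)} {k : Fin n} (hk : k ∈ S) (ω η : ∀ k, Ω k) :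
    resample S ω η k = η k := by simp [resample, hk]

theorem resample_apply_of_notMem {S : Set (Fin n)} {k : Fin n} (hk : k ∉ S) (ω η : ∀ k, Ω k) :
    resample S ω η k = ω k := by simp [resample, hk]

theorem resample_resample (S T : Set (Fin n)) (ω η η' : ∀ k, Ω k) :
    resample T (resample S ω η) η' = resample (S ∪ T) ω (resample T η η') := by
  funext k
  by_cases hT : k ∈ T <;> by_cases hS : k ∈ S <;> simp [resample, hT, hS]

theorem determinedBy_vbl (B : Set (∀ k, Ω k)) : DeterminedBy B (vbl B) := (isLeast_vbl B).1

theorem DeterminedBy.resample_mem_iff {B : Set (∀ k, Ω k)} {S T : Set (Fin n)}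
    (h : DeterminedBy B S) (hST : Disjoint S T) (ω η : ∀ k, Ω k) :
    resample T ω η ∈ B ↔ ω ∈ B :=
  h _ _ fun _ hk => resample_apply_of_notMem (Set.disjoint_left.1 hST hk) ω η

variable [∀ k, MeasurableSpace (Ω k)]

theorem measurable_resample (S : Set (Fin n)) :
    Measurable fun p : (∀ k, Ω k) × (∀ k, Ω k) => resample S p.1 p.2 := by
  refine measurable_pi_iff.2 fun k => ?_
  by_cases hk : k ∈ S
  · simp only [resample, hk, if_true]
    fun_prop
  · simp only [resample, hk, if_false]
    fun_prop

variable (μ : ∀ k, Measure (Ω k))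

theorem measurable_resample_right (S : Set (Fin n)) (ω : ∀ k, Ω k) : Measurable (resample S ω) :=
  (measurable_resample S).comp measurable_prodMk_left

/-- The expectation of `g` after the variables in `S` have been resampled. -/
noncomputable def refresh (S : Set (Fin n)) (g : (∀ k, Ω k) → ℝ≥0∞) (ω : ∀ k, Ω k) : ℝ≥0∞ :=
  ∫⁻ η, g (resample S ω η) ∂Measure.pi μ

theorem refresh_const_mul {μ : ∀ k, Measure (Ω k)} {S : Set (Fin n)}
    {g : (∀ k, Ω k) → ℝ≥0∞} (a : ℝ≥0∞) (hg : Measurable g) :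
    refresh μ S (fun ω => a * g ω) = fun ω => a * refresh μ S g ω := by
  funext ω
  exact lintegral_const_mul a (hg.comp (measurable_resample_right S ω))

variable [∀ k, IsProbabilityMeasure (μ k)]

/-- Exchanging some coordinates of two independent samples. -/
theorem measurePreserving_resample_swap (S : Set (Fin n)) :
    MeasurePreserving
      (fun p : (∀ k, Ω k) × (∀ k, Ω k) => (resample S p.1 p.2, resample S p.2 p.1))
      ((Measure.pi μ).prod (Measure.pi μ)) ((Measure.pi μ).prod (Measure.pi μ)) := by
  classical
  have hm : Measurable
      (fun p : (∀ k, Ω k) × (∀ k, Ω k) => (resample S p.1 p.2, resample S p.2 p.1)) :=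
    (measurable_resample S).prodMk ((measurable_resample S).comp measurable_swap)
  refine ⟨hm, ?_⟩
  let C : Set (Set (∀ k, Ω k)) := Set.pi Set.univ '' Set.pi Set.univ fun k => {s | MeasurableSet s}
  have hspan : (Measure.pi μ).FiniteSpanningSetsIn C :=
    ⟨fun _ => Set.univ, fun _ => ⟨fun _ => Set.univ, by simp, by simp⟩,
      fun _ => measure_lt_top _ _, Set.iUnion_const _⟩
  refine (Measure.prod_eq_generateFrom (C := C) (D := C) generateFrom_pi generateFrom_pi
    isPiSystem_pi isPiSystem_pi hspan hspan ?_).symm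
  rintro _ ⟨s, hs, rfl⟩ _ ⟨t, ht, rfl⟩
  replace hs : ∀ k, MeasurableSet (s k) := by simpa using hs
  replace ht : ∀ k, MeasurableSet (t k) := by simpa using ht
  rw [Measure.map_apply hm ((MeasurableSet.univ_pi hs).prod (MeasurableSet.univ_pi ht))]
  have : (fun p : (∀ k, Ω k) × (∀ k, Ω k) => (resample S p.1 p.2, resample S p.2 p.1)) ⁻¹'
      (Set.pi Set.univ s ×ˢ Set.pi Set.univ t) =
      (Set.pi Set.univ fun k => if k ∈ S then t k else s k) ×ˢ
        (Set.pi Set.univ fun k => if k ∈ S then s k else t k) := by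
    ext ⟨a, b⟩
    simp only [Set.mem_preimage, Set.mem_prod, Set.mem_pi, Set.mem_univ, true_imp_iff,
      ← forall_and]
    refine forall_congr' fun k => ?_
    by_cases hk : k ∈ S <;> simp [resample, hk, and_comm]
  rw [this, Measure.prod_prod, Measure.pi_pi, Measure.pi_pi, Measure.pi_pi, Measure.pi_pi,
    ← Finset.prod_mul_distrib, ← Finset.prod_mul_distrib]
  refine Finset.prod_congr rfl fun k _ => ?_
  by_cases hk : k ∈ S <;> simp [hk, mul_comm]

theorem measurePreserving_resample (S : Set (Fin n)) :
    MeasurePreserving (fun p : (∀ k, Ω k) × (∀ k, Ω k) => resample S p.1 p.2)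
      ((Measure.pi μ).prod (Measure.pi μ)) (Measure.pi μ) :=
  measurePreserving_fst.comp (measurePreserving_resample_swap μ S)

variable {μ} {S T : Set (Fin n)} {g : (∀ k, Ω k) → ℝ≥0∞}

theorem measurable_refresh (hg : Measurable g) : Measurable (refresh μ S g) :=
  (hg.comp (measurable_resample S)).lintegral_prod_right'

/-- Only the last value drawn for a variable survives, and a mixture of two fresh samples is again a
fresh sample. -/
theorem refresh_refresh (hg : Measurable g) :
    refresh μ S (refresh μ T g) = refresh μ (S ∪ T) g := by
  funext ω
  have hG : Measurable fun ζ => g (resample (S ∪ T) ω ζ) :=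
    hg.comp (measurable_resample_right _ ω)
  simp only [refresh, resample_resample]
  rw [← (measurePreserving_resample μ T).lintegral_comp hG, lintegral_prod]
  exact (hG.comp (measurable_resample T)).aemeasurable

theorem refresh_indicator {E : Set (∀ k, Ω k)} (hE : DeterminedBy E T) (hST : Disjoint T S) :
    refresh μ S (E.indicator g) = E.indicator (refresh μ S g) := by
  funext ω
  by_cases hω : ω ∈ E
  · simp [refresh, Set.indicator, hE.resample_mem_iff hST, hω]
  · simp [refresh, Set.indicator, hE.resample_mem_iff hST, hω]

theorem refresh_one : refresh μ S (fun _ => 1) = fun _ => 1 := by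
  funext ω; simp [refresh]

theorem refresh_empty : refresh μ ∅ g = g := by
  funext ω
  have : ∀ η : ∀ k, Ω k, resample ∅ ω η = ω := fun η => by funext k; simp [resample]
  simp [refresh, this]

/-- As `E` is decided by the variables in `S`, the assignment after redrawing them is independent of
whether `E` held before. Exchanging the coordinates in `S` between the old and the new sample makes
the integrand a product. -/
theorem lintegral_indicator_refresh {E : Set (∀ k, Ω k)} (hEm : MeasurableSet E)
    (hE : DeterminedBy E S) (hg : Measurable g) :
    ∫⁻ ω, E.indicator (refresh μ S g) ω ∂Measure.pi μ =
      Measure.pi μ E * ∫⁻ ω, g ω ∂Measure.pi μ := by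
  have hF : Measurable fun p : (∀ k, Ω k) × (∀ k, Ω k) => E.indicator 1 p.2 * g p.1 :=
    ((measurable_one.indicator hEm).comp measurable_snd).mul (hg.comp measurable_fst)
  have key : ∀ ω η : ∀ k, Ω k, E.indicator (1 : (∀ k, Ω k) → ℝ≥0∞) (resample S η ω) =
      E.indicator 1 ω := fun ω η => by
    have : resample S η ω ∈ E ↔ ω ∈ E :=
      hE _ _ fun k hk => resample_apply_of_mem hk η ω
    by_cases h : ω ∈ E <;> simp [Set.indicator, this, h]
  calc ∫⁻ ω, E.indicator (refresh μ S g) ω ∂Measure.pi μ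
      = ∫⁻ ω, ∫⁻ η, E.indicator 1 (resample S η ω) * g (resample S ω η)
          ∂Measure.pi μ ∂Measure.pi μ := by
        refine lintegral_congr fun ω => ?_
        simp only [key]
        by_cases h : ω ∈ E <;> simp [refresh, h]
    _ = ∫⁻ p, E.indicator 1 p.2 * g p.1 ∂(Measure.pi μ).prod (Measure.pi μ) := by
        rw [← (measurePreserving_resample_swap μ S).lintegral_comp hF, lintegral_prod]
        exact (hF.comp (measurePreserving_resample_swap μ S).measurable).aemeasurable
    _ = _ := by
        rw [lintegral_prod _ hF.aemeasurable]
        have : ∀ a : ∀ k, Ω k, ∫⁻ b, E.indicator 1 b * g a ∂Measure.pi μ =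
            Measure.pi μ E * g a := fun a => by
          rw [lintegral_mul_const _ (measurable_one.indicator hEm), lintegral_indicator_one hEm]
        simp only [this]
        rw [lintegral_const_mul _ hg]

end Resample

/-! ### Layerings, their operators, and the potential. -/

section Layers

variable {n : ℕ} {Ω : Fin n → Type u} {ι : Type v}

/-- The variables on which the events with index in `I` depend. -/
def vars (A : ι → Set (∀ k, Ω k)) (I : Finset ι) : Set (Fin n) := ⋃ i ∈ I, vbl (A i)

/-- A layering rooted in `R`: nonempty layers of events with index in `S`, such that the events of
a layer have disjoint sets of variables and each of them shares a variable with the layer before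
(with `R`, for the first layer). -/
def IsLayering (A : ι → Set (∀ k, Ω k)) (S : Finset ι) : Set (Fin n) → List (Finset ι) → Prop
  | _, [] => True
  | R, I :: L => I.Nonempty ∧ I ⊆ S ∧ (I : Set ι).PairwiseDisjoint (fun i => vbl (A i)) ∧
      (∀ i ∈ I, ¬ Disjoint (vbl (A i)) R) ∧ IsLayering A S (vars A I) L

/-- The event `A f` shares a variable with one of the layers. -/
def Meets (A : ι → Set (∀ k, Ω k)) (f : ι) (L : List (Finset ι)) : Prop :=
  ∃ I ∈ L, ¬ Disjoint (vbl (A f)) (vars A I)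

open Classical in
/-- Insert `f` right below the deepest layer with which `A f` shares a variable. -/
noncomputable def insertEvent (A : ι → Set (∀ k, Ω k)) (f : ι) :
    List (Finset ι) → List (Finset ι)
  | [] => [{f}]
  | I :: L => if Meets A f (I :: L) then I :: insertEvent A f L else insert f I :: L

variable {A : ι → Set (∀ k, Ω k)} {S : Finset ι} {R R' : Set (Fin n)} {f : ι}
  {I : Finset ι} {L L' : List (Finset ι)}

theorem vbl_subset_vars {i : ι} (hi : i ∈ I) : vbl (A i) ⊆ vars A I :=
  Set.subset_biUnion_of_mem (u := fun i => vbl (A i)) (Finset.mem_coe.2 hi)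

theorem vars_singleton : vars A {f} = vbl (A f) := by simp [vars]

theorem vars_insert [DecidableEq ι] : vars A (insert f I) = vbl (A f) ∪ vars A I := by
  simp [vars]

theorem vars_union [DecidableEq ι] {J : Finset ι} : vars A (I ∪ J) = vars A I ∪ vars A J := by
  simp [vars, Set.iUnion_or, Set.iUnion_union_distrib]

theorem disjoint_vars {T : Set (Fin n)} :
    Disjoint T (vars A I) ↔ ∀ i ∈ I, Disjoint T (vbl (A i)) := by
  simp [vars, Set.disjoint_iUnion_right]

theorem notMem_of_disjoint_vars (hf : (vbl (A f)).Nonempty)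
    (h : Disjoint (vbl (A f)) (vars A I)) : f ∉ I := fun hfI =>
  hf.ne_empty (disjoint_self.1 (h.mono_right (vbl_subset_vars hfI)))

theorem not_disjoint_vars_of_mem (hf : (vbl (A f)).Nonempty) (h : f ∈ I) :
    ¬ Disjoint (vbl (A f)) (vars A I) := fun hd => notMem_of_disjoint_vars hf hd h

@[simp] theorem not_meets_nil : ¬ Meets A f [] := by simp [Meets]

theorem meets_cons :
    Meets A f (I :: L) ↔ ¬ Disjoint (vbl (A f)) (vars A I) ∨ Meets A f L := by simp [Meets]

theorem IsLayering.mono (hR : R ⊆ R') (h : IsLayering A S R L) : IsLayering A S R' L := by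
  cases L with
  | nil => trivial
  | cons I L =>
    obtain ⟨h1, h2, h3, h4, h5⟩ := h
    exact ⟨h1, h2, h3, fun i hi hd => h4 i hi (hd.mono_right hR), h5⟩

theorem IsLayering.insertEvent (h : IsLayering A S R L) (hfS : f ∈ S)
    (hf : ¬ Disjoint (vbl (A f)) R ∨ Meets A f L) : IsLayering A S R (insertEvent A f L) := by
  classical
  induction L generalizing R with
  | nil =>
    have hR : ¬ Disjoint (vbl (A f)) R := by simpa using hf
    exact ⟨by simp, by simpa using hfS, by simp, by simpa using hR, trivial⟩
  | cons I L ih =>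
    obtain ⟨h1, h2, h3, h4, h5⟩ := h
    unfold LLL.insertEvent
    split_ifs with hm
    · exact ⟨h1, h2, h3, h4, ih h5 (meets_cons.1 hm)⟩
    · have hR := hf.resolve_right hm
      rw [meets_cons, not_or, not_not] at hm
      refine ⟨Finset.insert_nonempty _ _, Finset.insert_subset hfS h2, ?_, ?_, ?_⟩
      · rw [Finset.coe_insert]
        exact h3.insert fun i hi _ => disjoint_vars.1 hm.1 i hi
      · intro i hi
        rcases Finset.mem_insert.1 hi with rfl | hi
        · exact hR
        · exact h4 i hi
      · exact h5.mono (by rw [vars_insert]; exact Set.subset_union_right)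

theorem meets_insertEvent (hf : (vbl (A f)).Nonempty) : Meets A f (insertEvent A f L) := by
  classical
  induction L with
  | nil => exact meets_cons.2 (Or.inl (not_disjoint_vars_of_mem hf (by simp)))
  | cons I L ih =>
    unfold insertEvent
    split_ifs with hm
    · exact meets_cons.2 (Or.inr ih)
    · exact meets_cons.2 (Or.inl (not_disjoint_vars_of_mem hf (by simp)))

theorem insertEvent_ne_nil : insertEvent A f L ≠ [] := by
  cases L with
  | nil => simp [insertEvent]
  | cons I L => unfold insertEvent; split_ifs <;> simp

/-- In the result, `f` lies in the deepest layer that `A f` meets, so deleting it there recovers the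
layering. Since layers are nonempty, a new layer `{f}` cannot be confused with an old layer enlarged
by `f`. -/
theorem insertEvent_injective (hf : (vbl (A f)).Nonempty) (h : IsLayering A S R L)
    (h' : IsLayering A S R' L') (he : insertEvent A f L = insertEvent A f L') : L = L' := by
  classical
  have nil_cons : ∀ (R : Set (Fin n)) (I : Finset ι) (L : List (Finset ι)),
      IsLayering A S R (I :: L) → insertEvent A f [] ≠ insertEvent A f (I :: L) := by
    intro R I L h he
    simp only [insertEvent] at he
    split_ifs at he with hm
    · exact insertEvent_ne_nil (List.cons.inj he).2.symm
    · obtain ⟨i, hi⟩ := h.1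
      have hi' : i = f := by
        have : i ∈ ({f} : Finset ι) := by
          rw [(List.cons.inj he).1]; exact Finset.mem_insert_of_mem hi
        simpa using this
      exact hm (meets_cons.2 (Or.inl (not_disjoint_vars_of_mem hf (hi' ▸ hi))))
  induction L generalizing R R' L' with
  | nil =>
    cases L' with
    | nil => rfl
    | cons I' L' => exact absurd he (nil_cons R' I' L' h')
  | cons I L ih =>
    cases L' with
    | nil => exact absurd he.symm (nil_cons R I L h)
    | cons I' L' =>
      simp only [insertEvent] at he
      split_ifs at he with hm hm' hm'
      · obtain ⟨h1, h2⟩ := List.cons.inj he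
        rw [h1, ih h.2.2.2.2 h'.2.2.2.2 h2]
      · exact absurd (meets_cons.2 (Or.inr ((List.cons.inj he).2 ▸ meets_insertEvent hf))) hm'
      · exact absurd (meets_cons.2 (Or.inr ((List.cons.inj he).2.symm ▸ meets_insertEvent hf))) hm
      · obtain ⟨h1, h2⟩ := List.cons.inj he
        rw [meets_cons, not_or, not_not] at hm hm'
        rw [h2, ← Finset.erase_insert (notMem_of_disjoint_vars hf hm.1), h1,
          Finset.erase_insert (notMem_of_disjoint_vars hf hm'.1)]

open Classical in
/-- The layering after one more resampling, of `A f`, at the beginning of the execution. -/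
noncomputable def pushEvent (hfS : f ∈ S) (L : {L // IsLayering A S R L}) :
    {L // IsLayering A S R L} :=
  if h : ¬ Disjoint (vbl (A f)) R ∨ Meets A f L.1 then
    ⟨insertEvent A f L.1, L.2.insertEvent hfS h⟩ else L

/-- A layering that is left unchanged does not meet `A f`, while one that has received `f` does; so
the two cases have disjoint images. -/
theorem pushEvent_injective (hf : (vbl (A f)).Nonempty) (hfS : f ∈ S) :
    Function.Injective (pushEvent (A := A) (R := R) hfS) := by
  intro L L' he
  unfold pushEvent at he
  split_ifs at he with h h' h'
  · exact Subtype.ext (insertEvent_injective hf L.2 L'.2 (congrArg Subtype.val he))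
  · exact absurd (Or.inr (congrArg Subtype.val he ▸ meets_insertEvent hf)) h'
  · exact absurd (Or.inr ((congrArg Subtype.val he).symm ▸ meets_insertEvent hf)) h
  · exact he

theorem determinedBy_biInter (A : ι → Set (∀ k, Ω k)) (I : Finset ι) :
    DeterminedBy (⋂ i ∈ I, A i) (vars A I) := by
  intro ω ω' hω
  simp only [Set.mem_iInter]
  exact forall₂_congr fun i hi =>
    determinedBy_vbl (A i) ω ω' fun k hk => hω k (vbl_subset_vars hi hk)

variable [∀ k, MeasurableSpace (Ω k)]

/-- Expectation of `g` after the variables of the events in `I` have been resampled, where all of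
these events have to hold before, with weight `lam` for each event. -/
noncomputable def layerOp (μ : ∀ k, Measure (Ω k)) (A : ι → Set (∀ k, Ω k)) (lam : ℝ≥0∞)
    (I : Finset ι) (g : (∀ k, Ω k) → ℝ≥0∞) (ω : ∀ k, Ω k) : ℝ≥0∞ :=
  lam ^ I.card * (⋂ i ∈ I, A i).indicator (refresh μ (vars A I) g) ω

/-- The layers act on `h`, the first layer of the list first. -/
noncomputable def layersOp (μ : ∀ k, Measure (Ω k)) (A : ι → Set (∀ k, Ω k)) (lam : ℝ≥0∞) :
    ((∀ k, Ω k) → ℝ≥0∞) → List (Finset ι) → (∀ k, Ω k) → ℝ≥0∞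
  | h, [] => h
  | h, I :: L => layersOp μ A lam (layerOp μ A lam I h) L

/-- The sum of all layerings rooted in `R`, applied to `h`. -/
noncomputable def potential (μ : ∀ k, Measure (Ω k)) (A : ι → Set (∀ k, Ω k)) (lam : ℝ≥0∞)
    (S : Finset ι) (R : Set (Fin n)) (h : (∀ k, Ω k) → ℝ≥0∞) (ω : ∀ k, Ω k) : ℝ≥0∞ :=
  ∑' L : {L // IsLayering A S R L}, layersOp μ A lam h L.1 ω

variable {μ : ∀ k, Measure (Ω k)} {lam : ℝ≥0∞} {g h : (∀ k, Ω k) → ℝ≥0∞} {J : Finset ι}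

theorem le_potential (ω : ∀ k, Ω k) : h ω ≤ potential μ A lam S R h ω :=
  ENNReal.le_tsum (f := fun L : {L // IsLayering A S R L} => layersOp μ A lam h L.1 ω) ⟨[], trivial⟩

variable [∀ k, IsProbabilityMeasure (μ k)]

theorem measurable_layerOp (hA : ∀ i, MeasurableSet (A i)) (hg : Measurable g) :
    Measurable (layerOp μ A lam I g) :=
  ((measurable_refresh hg).indicator (I.measurableSet_biInter fun i _ => hA i)).const_mul _

theorem measurable_layersOp (hA : ∀ i, MeasurableSet (A i)) (hh : Measurable h) :
    Measurable (layersOp μ A lam h L) := by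
  induction L generalizing h with
  | nil => exact hh
  | cons I L ih => exact ih (measurable_layerOp hA hh)

theorem measurable_potential [Countable ι] (hA : ∀ i, MeasurableSet (A i)) (hh : Measurable h) :
    Measurable (potential μ A lam S R h) :=
  Measurable.tsum fun _ => measurable_layersOp hA hh

theorem refresh_layerOp {T : Set (Fin n)} (hA : ∀ i, MeasurableSet (A i)) (hg : Measurable g)
    (hT : Disjoint T (vars A I)) :
    refresh μ T (layerOp μ A lam I g) = layerOp μ A lam I (refresh μ T g) := by
  have h1 : Measurable ((⋂ i ∈ I, A i).indicator (refresh μ (vars A I) g)) :=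
    (measurable_refresh hg).indicator (I.measurableSet_biInter fun i _ => hA i)
  unfold layerOp
  rw [refresh_const_mul _ h1, refresh_indicator (determinedBy_biInter A I) hT.symm,
    refresh_refresh hg, refresh_refresh hg, Set.union_comm]

/-- Redrawing the variables of `I` cannot affect whether the events of `J` hold, so all requirements
may be checked before any resampling. -/
theorem layerOp_layerOp [DecidableEq ι] (hA : ∀ i, MeasurableSet (A i)) (hg : Measurable g)
    (hIJ : Disjoint I J) (hd : Disjoint (vars A I) (vars A J)) :
    layerOp μ A lam I (layerOp μ A lam J g) = layerOp μ A lam (I ∪ J) g := by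
  have h1 : ∀ ω, layerOp μ A lam I (layerOp μ A lam J g) ω = lam ^ I.card *
      (⋂ i ∈ I, A i).indicator (refresh μ (vars A I) (layerOp μ A lam J g)) ω := fun ω => rfl
  funext ω
  rw [h1, refresh_layerOp hA hg hd]
  have hE : (⋂ i ∈ I ∪ J, A i) = (⋂ i ∈ I, A i) ∩ ⋂ i ∈ J, A i := by
    ext ω
    simp only [Set.mem_iInter, Finset.mem_union, Set.mem_inter_iff, or_imp, forall_and]
  have h2 : layerOp μ A lam J (refresh μ (vars A I) g) ω = lam ^ J.card *
      (⋂ i ∈ J, A i).indicator (refresh μ (vars A I ∪ vars A J) g) ω := by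
    rw [layerOp, refresh_refresh hg, Set.union_comm]
  rw [layerOp, hE, vars_union, Finset.card_union_of_disjoint hIJ]
  by_cases hI : ω ∈ ⋂ i ∈ I, A i
  · by_cases hJ : ω ∈ ⋂ i ∈ J, A i
    · rw [Set.indicator_of_mem hI, h2, Set.indicator_of_mem hJ, Set.indicator_of_mem (Set.mem_inter hI hJ),
        pow_add, mul_assoc]
    · rw [Set.indicator_of_mem hI, h2, Set.indicator_of_notMem hJ,
        Set.indicator_of_notMem fun h => hJ h.2]
      simp
  · rw [Set.indicator_of_notMem hI, Set.indicator_of_notMem fun h => hI h.1]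
    simp

theorem layerOp_singleton_comm (hA : ∀ i, MeasurableSet (A i)) (hg : Measurable g)
    (hf : (vbl (A f)).Nonempty) (hd : Disjoint (vbl (A f)) (vars A I)) :
    layerOp μ A lam {f} (layerOp μ A lam I g) = layerOp μ A lam I (layerOp μ A lam {f} g) := by
  classical
  have hfI : Disjoint {f} I :=
    Finset.disjoint_singleton_left.2 (notMem_of_disjoint_vars hf hd)
  rw [← vars_singleton] at hd
  rw [layerOp_layerOp hA hg hfI hd, layerOp_layerOp hA hg hfI.symm hd.symm, Finset.union_comm]

theorem layerOp_layersOp_of_not_meets (hA : ∀ i, MeasurableSet (A i)) (hh : Measurable h)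
    (hf : (vbl (A f)).Nonempty) (hL : ¬ Meets A f L) :
    layerOp μ A lam {f} (layersOp μ A lam h L) = layersOp μ A lam (layerOp μ A lam {f} h) L := by
  induction L generalizing h with
  | nil => rfl
  | cons I L ih =>
    rw [meets_cons, not_or, not_not] at hL
    simp only [layersOp]
    rw [ih (measurable_layerOp hA hh) hL.2, layerOp_singleton_comm hA hh hf hL.1]

theorem refresh_layersOp_of_not_meets (hA : ∀ i, MeasurableSet (A i)) (hh : Measurable h)
    (hR : refresh μ (vbl (A f)) h = h) (hL : ¬ Meets A f L) :
    refresh μ (vbl (A f)) (layersOp μ A lam h L) = layersOp μ A lam h L := by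
  induction L generalizing h with
  | nil => exact hR
  | cons I L ih =>
    rw [meets_cons, not_or, not_not] at hL
    refine ih (measurable_layerOp hA hh) ?_ hL.2
    rw [refresh_layerOp hA hh hL.1, hR]

/-- The operator of `f` starts outermost, as the earliest resampling. It commutes inwards past the
deeper layers, which `A f` does not meet, and merges with the layer that receives `f`. -/
theorem layersOp_insertEvent (hA : ∀ i, MeasurableSet (A i)) (hh : Measurable h)
    (hf : (vbl (A f)).Nonempty) :
    layersOp μ A lam h (insertEvent A f L) = layerOp μ A lam {f} (layersOp μ A lam h L) := by
  classical
  induction L generalizing h with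
  | nil => rfl
  | cons I L ih =>
    unfold insertEvent
    split_ifs with hm
    · exact ih (measurable_layerOp hA hh)
    · rw [meets_cons, not_or, not_not] at hm
      simp only [layersOp]
      rw [layerOp_layersOp_of_not_meets hA (measurable_layerOp hA hh) hf hm.2,
        layerOp_layerOp hA hh (Finset.disjoint_singleton_left.2 (notMem_of_disjoint_vars hf hm.1))
          (by rw [vars_singleton]; exact hm.1), Finset.insert_eq]

open Classical in
/-- Resampling an event that holds does not increase the potential in expectation; if the event
shares a variable with the root, the potential even decreases by a factor of `lam`. -/
theorem mul_refresh_potential_le [Countable ι] (hA : ∀ i, MeasurableSet (A i)) (hh : Measurable h)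
    (hlam : 1 ≤ lam) (hf : (vbl (A f)).Nonempty) (hfS : f ∈ S)
    (hR : Disjoint (vbl (A f)) R → refresh μ (vbl (A f)) h = h) {ω : ∀ k, Ω k} (hω : ω ∈ A f) :
    (if Disjoint (vbl (A f)) R then 1 else lam) *
      refresh μ (vbl (A f)) (potential μ A lam S R h) ω ≤ potential μ A lam S R h ω := by
  have hsum : refresh μ (vbl (A f)) (potential μ A lam S R h) ω =
      ∑' L : {L // IsLayering A S R L}, refresh μ (vbl (A f)) (layersOp μ A lam h L.1) ω :=
    lintegral_tsum fun L =>
      ((measurable_layersOp hA hh).comp (measurable_resample_right _ ω)).aemeasurable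
  rw [hsum, ← ENNReal.tsum_mul_left]
  -- Each layering is charged to its image under `pushEvent`; by injectivity no term of the
  -- potential is charged twice.
  refine le_trans (ENNReal.tsum_le_tsum fun L => ?_)
    (ENNReal.tsum_comp_le_tsum_of_injective (pushEvent_injective hf hfS)
      fun L : {L // IsLayering A S R L} => layersOp μ A lam h L.1 ω)
  have hop : lam * refresh μ (vbl (A f)) (layersOp μ A lam h L.1) ω =
      layersOp μ A lam h (insertEvent A f L.1) ω := by
    rw [layersOp_insertEvent hA hh hf]
    simp [layerOp, vars_singleton, hω]
  simp only [pushEvent]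
  by_cases hd : Disjoint (vbl (A f)) R
  · rw [if_pos hd, one_mul]
    split_ifs with hc
    · rw [← hop]
      exact le_mul_of_one_le_left zero_le hlam
    · rw [not_or, not_not] at hc
      rw [refresh_layersOp_of_not_meets hA hh (hR hd) hc.2]
  · rw [if_neg hd, hop, dif_pos (Or.inl hd)]

/-- The events of a layer can be split off one at a time, and each is independent of what is seen
once its variables are redrawn. -/
theorem lintegral_layerOp (hA : ∀ i, MeasurableSet (A i)) (hg : Measurable g)
    (hI : (I : Set ι).PairwiseDisjoint fun i => vbl (A i)) (hne : ∀ i ∈ I, (vbl (A i)).Nonempty) :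
    ∫⁻ ω, layerOp μ A lam I g ω ∂Measure.pi μ =
      (∏ i ∈ I, lam * Measure.pi μ (A i)) * ∫⁻ ω, g ω ∂Measure.pi μ := by
  classical
  induction I using Finset.induction_on with
  | empty => simp [layerOp, vars, refresh_empty]
  | insert f I hf ih =>
    rw [Finset.coe_insert, Set.pairwiseDisjoint_insert_of_notMem (by simpa using hf)] at hI
    have hd : Disjoint (vbl (A f)) (vars A I) := disjoint_vars.2 fun i hi => hI.2 i hi
    rw [Finset.insert_eq, ← layerOp_layerOp hA hg (Finset.disjoint_singleton_left.2 hf)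
      (by rwa [vars_singleton]), ← Finset.insert_eq, Finset.prod_insert hf, mul_assoc,
      ← ih hI.1 fun i hi => hne i (Finset.mem_insert_of_mem hi)]
    have hm : Measurable (layerOp μ A lam I g) := measurable_layerOp hA hg
    have h1 : ∀ ω, layerOp μ A lam {f} (layerOp μ A lam I g) ω =
        lam * (A f).indicator (refresh μ (vbl (A f)) (layerOp μ A lam I g)) ω := fun ω => by
      simp [layerOp, vars_singleton]
    simp only [h1]
    rw [lintegral_const_mul _ ((measurable_refresh hm).indicator (hA f)),
      lintegral_indicator_refresh (hA f) (determinedBy_vbl _) hm, mul_assoc]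

/-- The total weight of a layering. -/
noncomputable def layersWeight (w : ι → ℝ≥0∞) (L : List (Finset ι)) : ℝ≥0∞ :=
  (L.map fun I => ∏ i ∈ I, w i).prod

theorem lintegral_layersOp (hA : ∀ i, MeasurableSet (A i)) (hh : Measurable h)
    (hne : ∀ i ∈ S, (vbl (A i)).Nonempty) (hL : IsLayering A S R L) :
    ∫⁻ ω, layersOp μ A lam h L ω ∂Measure.pi μ =
      layersWeight (fun i => lam * Measure.pi μ (A i)) L * ∫⁻ ω, h ω ∂Measure.pi μ := by
  induction L generalizing h R with
  | nil => simp [layersOp, layersWeight]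
  | cons I L ih =>
    obtain ⟨-, h2, h3, -, h5⟩ := hL
    simp only [layersOp]
    rw [ih (measurable_layerOp hA hh) h5,
      lintegral_layerOp hA hh h3 fun i hi => hne i (h2 hi)]
    simp only [layersWeight, List.map_cons, List.prod_cons]
    ring

theorem lintegral_potential [Countable ι] (hA : ∀ i, MeasurableSet (A i)) (hh : Measurable h)
    (hne : ∀ i ∈ S, (vbl (A i)).Nonempty) :
    ∫⁻ ω, potential μ A lam S R h ω ∂Measure.pi μ =
      (∑' L : {L // IsLayering A S R L},
        layersWeight (fun i => lam * Measure.pi μ (A i)) L.1) * ∫⁻ ω, h ω ∂Measure.pi μ := by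
  unfold potential
  rw [lintegral_tsum fun L => (measurable_layersOp hA hh).aemeasurable, ← ENNReal.tsum_mul_right]
  exact tsum_congr fun L => lintegral_layersOp hA hh hne L.2

end Layers

/-! ### The total weight of all layerings. -/

section LayeringSum

theorem _root_.ENNReal.tsum_list {α : Type*} (F : List α → ℝ≥0∞) :
    ∑' L, F L = F [] + ∑' a, ∑' L, F (a :: L) := by
  let e : List α ≃ Unit ⊕ (α × List α) :=
    { toFun := fun L => match L with
        | [] => Sum.inl ()
        | a :: L => Sum.inr (a, L)
      invFun := fun x => match x with
        | Sum.inl _ => []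
        | Sum.inr p => p.1 :: p.2
      left_inv := by rintro (_ | _) <;> rfl
      right_inv := by rintro (_ | _) <;> rfl }
  rw [← e.symm.tsum_eq, Summable.tsum_sum ENNReal.summable ENNReal.summable,
    ← ENNReal.tsum_prod]
  simp [e]

variable {n : ℕ} {Ω : Fin n → Type u} {ι : Type v}

open Classical in
/-- The indices in `S` of the events that depend on some variable in `R`. -/
noncomputable def touching (A : ι → Set (∀ k, Ω k)) (S : Finset ι) (R : Set (Fin n)) : Finset ι :=
  S.filter fun j => ¬ Disjoint (vbl (A j)) R

open Classical in
/-- The possible first layers of a layering rooted in `R`. -/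
noncomputable def firstLayers (A : ι → Set (∀ k, Ω k)) (S : Finset ι) (R : Set (Fin n)) :
    Finset (Finset ι) :=
  (touching A S R).powerset.filter fun I =>
    I.Nonempty ∧ (I : Set ι).PairwiseDisjoint fun i => vbl (A i)

variable {A : ι → Set (∀ k, Ω k)} {S : Finset ι} {R : Set (Fin n)} {w y : ι → ℝ≥0∞}

theorem isLayering_cons {I : Finset ι} {L : List (Finset ι)} :
    IsLayering A S R (I :: L) ↔ I ∈ firstLayers A S R ∧ IsLayering A S (vars A I) L := by
  simp only [IsLayering, firstLayers, touching, Finset.mem_filter, Finset.mem_powerset,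
    Finset.subset_iff]
  constructor
  · rintro ⟨h1, h2, h3, h4, h5⟩
    exact ⟨⟨fun i hi => ⟨h2 hi, h4 i hi⟩, h1, h3⟩, h5⟩
  · rintro ⟨⟨h2, h1, h3⟩, h5⟩
    exact ⟨h1, fun i hi => (h2 hi).1, h3, fun i hi => (h2 hi).2, h5⟩

/-- An event may touch several members of `I`; counting it repeatedly is harmless because the
factors are at least `1`. -/
theorem prod_touching_vars_le (I : Finset ι) :
    ∏ j ∈ touching A S (vars A I), (1 + y j) ≤
      ∏ i ∈ I, ∏ j ∈ touching A S (vbl (A i)), (1 + y j) := by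
  classical
  induction I using Finset.induction_on with
  | empty => simp [touching, vars]
  | insert f I hf ih =>
    have : touching A S (vars A (insert f I)) =
        touching A S (vbl (A f)) ∪ touching A S (vars A I) := by
      ext j
      simp only [touching, vars_insert, Finset.mem_filter, Finset.mem_union,
        Set.disjoint_union_right, not_and_or, ← and_or_left]
    rw [this, Finset.prod_insert hf]
    refine le_trans ?_ (mul_le_mul_right ih _)
    rw [← Finset.prod_union_inter]
    exact le_mul_of_one_le_right zero_le (Finset.one_le_prod' fun j _ => le_self_add)

/-- The expanded product runs over all sets of touching events; the first layers are some of the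
nonempty ones. -/
theorem sum_firstLayers_le :
    1 + ∑ I ∈ firstLayers A S R, ∏ i ∈ I, y i ≤ ∏ j ∈ touching A S R, (1 + y j) := by
  classical
  rw [Finset.prod_one_add, ← Finset.sum_erase_add _ _ (Finset.empty_mem_powerset _),
    Finset.prod_empty, add_comm]
  gcongr
  intro I hI
  obtain ⟨h1, h2, -⟩ := Finset.mem_filter.1 hI
  exact Finset.mem_erase.2 ⟨h2.ne_empty, h1⟩

/-- Two events that depend on `k` are never disjoint, so a first layer is a single event. The
resulting sum stays polynomial where the product of the `1 + y j` could be exponential in `log (1 /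
δ)`. -/
theorem sum_firstLayers_singleton_le (k : Fin n) :
    ∑ I ∈ firstLayers A S {k}, ∏ i ∈ I, y i ≤ ∑ j ∈ touching A S {k}, y j := by
  classical
  have hsub : firstLayers A S {k} ⊆ (touching A S {k}).image fun j => {j} := by
    intro I hI
    obtain ⟨h1, ⟨i, hi⟩, h3⟩ := Finset.mem_filter.1 hI
    rw [Finset.mem_powerset] at h1
    refine Finset.mem_image.2 ⟨i, h1 hi, (Finset.eq_singleton_iff_unique_mem.2 ⟨hi, ?_⟩).symm⟩
    intro j hj
    by_contra hne
    have hmem : ∀ l ∈ I, k ∈ vbl (A l) := fun l hl => by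
      simpa using (Finset.mem_filter.1 (h1 hl)).2
    exact Set.disjoint_left.1 (h3 hj hi hne) (hmem j hj) (hmem i hi)
  refine (Finset.sum_le_sum_of_subset hsub).trans ?_
  rw [Finset.sum_image fun a _ b _ h => Finset.singleton_injective h]
  simp

variable [Fintype ι]

-- Bounding the depth permits an induction that splits off the first layer `I`. The layers below are
-- rooted in `vars A I`, and `hw` absorbs their contribution into the product of the `y i`. The
-- bound does not depend on `d`.
open Classical in
theorem tsum_layersWeight_length_lt_le
    (hw : ∀ i ∈ S, w i * ∏ j ∈ touching A S (vbl (A i)), (1 + y j) ≤ y i) (d : ℕ) :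
    ∑' L : List (Finset ι), (if IsLayering A S R L ∧ L.length < d then layersWeight w L else 0) ≤
      1 + ∑ I ∈ firstLayers A S R, ∏ i ∈ I, y i := by
  induction d generalizing R with
  | zero => simp
  | succ d ih =>
    rw [ENNReal.tsum_list, tsum_fintype]
    refine add_le_add (by simp [IsLayering, layersWeight]) ?_
    rw [← Finset.sum_filter_add_sum_filter_not Finset.univ (· ∈ firstLayers A S R),
      Finset.sum_eq_zero (s := Finset.univ.filter (· ∉ firstLayers A S R)), add_zero,
      Finset.filter_univ_mem]
    · refine Finset.sum_le_sum fun I hI => ?_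
      have hIS : ∀ i ∈ I, i ∈ S := fun i hi =>
        (Finset.mem_filter.1 (Finset.mem_powerset.1 (Finset.mem_filter.1 hI).1 hi)).1
      calc ∑' L : List (Finset ι), (if IsLayering A S R (I :: L) ∧ (I :: L).length < d + 1 then
              layersWeight w (I :: L) else 0)
          = (∏ i ∈ I, w i) * ∑' L : List (Finset ι),
              (if IsLayering A S (vars A I) L ∧ L.length < d then layersWeight w L else 0) := by
            rw [← ENNReal.tsum_mul_left]
            refine tsum_congr fun L => ?_
            simp only [isLayering_cons, hI, true_and, List.length_cons, add_lt_add_iff_right,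
              mul_ite, mul_zero]
            simp [layersWeight]
        _ ≤ (∏ i ∈ I, w i) * ∏ j ∈ touching A S (vars A I), (1 + y j) :=
            mul_le_mul_right (ih.trans sum_firstLayers_le) _
        _ ≤ (∏ i ∈ I, w i) * ∏ i ∈ I, ∏ j ∈ touching A S (vbl (A i)), (1 + y j) :=
            mul_le_mul_right (prod_touching_vars_le I) _
        _ ≤ ∏ i ∈ I, y i := by
            rw [← Finset.prod_mul_distrib]
            exact Finset.prod_le_prod' fun i hi => hw i (hIS i hi)
    · intro I hI
      simp [isLayering_cons, (Finset.mem_filter.1 hI).2]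

/-- The total weight of all layerings rooted in `R`, under the local lemma condition. -/
theorem tsum_layersWeight_le
    (hw : ∀ i ∈ S, w i * ∏ j ∈ touching A S (vbl (A i)), (1 + y j) ≤ y i) :
    ∑' L : {L // IsLayering A S R L}, layersWeight w L.1 ≤
      1 + ∑ I ∈ firstLayers A S R, ∏ i ∈ I, y i := by
  classical
  -- Finitely many layerings have bounded depth, and the truncated bound is uniform in the depth.
  rw [ENNReal.tsum_eq_iSup_sum]
  refine iSup_le fun T => ?_
  let d := T.sup (fun L => L.1.length) + 1
  refine le_trans ?_ (tsum_layersWeight_length_lt_le hw d)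
  refine le_trans ?_ (ENNReal.tsum_comp_le_tsum_of_injective
    (Subtype.val_injective (p := IsLayering A S R)) _)
  refine le_trans (Finset.sum_le_sum fun L hL => ?_) (ENNReal.sum_le_tsum T)
  rw [if_pos ⟨L.2, Nat.lt_succ_of_le (Finset.le_sup (f := fun L => L.1.length) hL)⟩]

end LayeringSum

/-! ### The loop as a random process, and supermartingale bounds for it. -/

theorem measurePreserving_update_infinitePi {X : Type*} [MeasurableSpace X] (ν : Measure X)
    [IsProbabilityMeasure ν] (t : ℕ) :
    MeasurePreserving (fun p : X × (ℕ → X) => Function.update p.2 t p.1)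
      (ν.prod (Measure.infinitePi fun _ : ℕ => ν)) (Measure.infinitePi fun _ : ℕ => ν) := by
  classical
  have hm : Measurable fun p : X × (ℕ → X) => Function.update p.2 t p.1 := by
    refine measurable_pi_iff.2 fun s => ?_
    by_cases hs : s = t
    · subst hs; simpa using measurable_fst
    · simp only [Function.update_of_ne hs]; fun_prop
  refine ⟨hm, Measure.eq_infinitePi _ fun s B hB => ?_⟩
  have hBt : MeasurableSet (if t ∈ s then B t else Set.univ) := by
    split_ifs
    exacts [hB t, MeasurableSet.univ]
  have : (fun p : X × (ℕ → X) => Function.update p.2 t p.1) ⁻¹' Set.pi s B =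
      (if t ∈ s then B t else Set.univ) ×ˢ Set.pi (s.erase t) B := by
    ext ⟨a, ξ⟩
    simp only [Set.mem_preimage, Set.mem_pi, Set.mem_prod, Finset.mem_coe, Finset.mem_erase]
    constructor
    · intro h
      refine ⟨?_, fun r hr => by simpa [Function.update_of_ne hr.1] using h r hr.2⟩
      split_ifs with ht
      · simpa using h t ht
      · trivial
    · rintro ⟨h1, h2⟩ r hr
      by_cases hrt : r = t
      · subst hrt; simpa [hr] using h1
      · simpa [Function.update_of_ne hrt] using h2 r ⟨hrt, hr⟩
  rw [Measure.map_apply hm (MeasurableSet.pi s.countable_toSet fun i _ => hB i), this,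
    Measure.prod_prod, Measure.infinitePi_pi _ fun i _ => hB i]
  split_ifs with ht
  · exact Finset.mul_prod_erase s (fun i => ν (B i)) ht
  · rw [Finset.erase_eq_of_notMem ht, measure_univ, one_mul]

section Loop

variable {n : ℕ} {Ω : Fin n → Type u} [∀ k, MeasurableSpace (Ω k)] {ι : Type v}
  {A : ι → Set (∀ k, Ω k)} {S : Finset ι} (V : Verifier A S)

theorem mtLoop_of_find_none (ξ : ℕ → ∀ k, Ω k) (K t : ℕ) {ω : ∀ k, Ω k} (h : V.find ω = none) :
    mtLoop V ξ K t ω = ⟨some ω, 0, V.cost ω⟩ := by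
  cases K <;> simp [mtLoop, h]

theorem mtLoop_zero_of_find_some (ξ : ℕ → ∀ k, Ω k) (t : ℕ) {ω : ∀ k, Ω k} {i : ι}
    (h : V.find ω = some i) : mtLoop V ξ 0 t ω = ⟨none, 0, V.cost ω⟩ := by
  simp [mtLoop, h]

theorem mtLoop_succ_of_find_some (ξ : ℕ → ∀ k, Ω k) (K t : ℕ) {ω : ∀ k, Ω k} {i : ι}
    (h : V.find ω = some i) :
    mtLoop V ξ (K + 1) t ω =
      ⟨(mtLoop V ξ K (t + 1) (resample (vbl (A i)) ω (ξ t))).result,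
        (mtLoop V ξ K (t + 1) (resample (vbl (A i)) ω (ξ t))).resamplings + 1,
        V.cost ω + (vbl (A i)).ncard +
          (mtLoop V ξ K (t + 1) (resample (vbl (A i)) ω (ξ t))).steps⟩ := by
  simp [mtLoop, h]

theorem mtLoop_congr {ξ ξ' : ℕ → ∀ k, Ω k} (K t : ℕ) (ω : ∀ k, Ω k)
    (h : ∀ s, t ≤ s → ξ s = ξ' s) : mtLoop V ξ K t ω = mtLoop V ξ' K t ω := by
  induction K generalizing t ω with
  | zero =>
    cases hf : V.find ω with
    | none => simp only [mtLoop_of_find_none V _ _ _ hf]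
    | some i => simp only [mtLoop_zero_of_find_some V _ _ hf]
  | succ K ih =>
    cases hf : V.find ω with
    | none => simp only [mtLoop_of_find_none V _ _ _ hf]
    | some i =>
      simp only [mtLoop_succ_of_find_some V _ _ _ hf]
      rw [h t le_rfl, ih (t + 1) _ fun s hs => h s (by omega)]

theorem resamplings_mtLoop_le (ξ : ℕ → ∀ k, Ω k) (K t : ℕ) (ω : ∀ k, Ω k) :
    (mtLoop V ξ K t ω).resamplings ≤ K := by
  induction K generalizing t ω with
  | zero =>
    cases hf : V.find ω with
    | none => simp [mtLoop_of_find_none V _ _ _ hf]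
    | some i => simp [mtLoop_zero_of_find_some V _ _ hf]
  | succ K ih =>
    cases hf : V.find ω with
    | none => simp [mtLoop_of_find_none V _ _ _ hf]
    | some i =>
      simp only [mtLoop_succ_of_find_some V _ _ _ hf]
      exact Nat.succ_le_succ (ih _ _)

theorem steps_mtLoop_le {τ : ℕ} (hτ : ∀ ω, V.cost ω ≤ τ) (ξ : ℕ → ∀ k, Ω k) (K t : ℕ)
    (ω : ∀ k, Ω k) : (mtLoop V ξ K t ω).steps ≤ K * (n + τ) + τ := by
  induction K generalizing t ω with
  | zero =>
    cases hf : V.find ω with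
    | none => simp [mtLoop_of_find_none V _ _ _ hf, hτ]
    | some i => simp [mtLoop_zero_of_find_some V _ _ hf, hτ]
  | succ K ih =>
    cases hf : V.find ω with
    | none =>
      simp only [mtLoop_of_find_none V _ _ _ hf]
      exact (hτ ω).trans (Nat.le_add_left _ _)
    | some i =>
      simp only [mtLoop_succ_of_find_some V _ _ _ hf]
      have h1 := ih (t + 1) (resample (vbl (A i)) ω (ξ t))
      have h2 : (vbl (A i)).ncard ≤ n := by
        simpa using Set.ncard_le_card (vbl (A i))
      have h3 := hτ ω
      calc _ ≤ τ + n + (K * (n + τ) + τ) := by gcongr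
        _ = _ := by ring

theorem find_eq_none_of_result_mtLoop (ξ : ℕ → ∀ k, Ω k) (K t : ℕ) (ω : ∀ k, Ω k) {ω' : ∀ k, Ω k}
    (h : (mtLoop V ξ K t ω).result = some ω') : V.find ω' = none := by
  induction K generalizing t ω with
  | zero =>
    cases hf : V.find ω with
    | none =>
      rw [mtLoop_of_find_none V _ _ _ hf] at h
      rwa [← Option.some.inj h]
    | some i => simp [mtLoop_zero_of_find_some V _ _ hf] at h
  | succ K ih =>
    cases hf : V.find ω with
    | none =>
      rw [mtLoop_of_find_none V _ _ _ hf] at h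
      rwa [← Option.some.inj h]
    | some i =>
      rw [mtLoop_succ_of_find_some V _ _ _ hf] at h
      exact ih _ _ h

theorem measurableSet_result_mtLoop [Finite ι] {E : Set (Option (∀ k, Ω k))}
    (hE : MeasurableSet {ω | some ω ∈ E}) (K t : ℕ) :
    MeasurableSet {p : (∀ k, Ω k) × (ℕ → ∀ k, Ω k) | (mtLoop V p.2 K t p.1).result ∈ E} := by
  have hsome : ∀ i, MeasurableSet {p : (∀ k, Ω k) × (ℕ → ∀ k, Ω k) | V.find p.1 = some i} :=
    fun i => measurable_fst (V.measurable_find i)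
  have hnone : MeasurableSet {p : (∀ k, Ω k) × (ℕ → ∀ k, Ω k) | V.find p.1 = none} := by
    have : {p : (∀ k, Ω k) × (ℕ → ∀ k, Ω k) | V.find p.1 = none} =
        (⋃ i, {p : (∀ k, Ω k) × (ℕ → ∀ k, Ω k) | V.find p.1 = some i})ᶜ := by
      ext p
      simp [Option.eq_none_iff_forall_ne_some]
    rw [this]
    exact (MeasurableSet.iUnion hsome).compl
  have hE' : MeasurableSet {p : (∀ k, Ω k) × (ℕ → ∀ k, Ω k) | some p.1 ∈ E} := measurable_fst hE
  induction K generalizing t with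
  | zero =>
    have : {p : (∀ k, Ω k) × (ℕ → ∀ k, Ω k) | (mtLoop V p.2 0 t p.1).result ∈ E} =
        ({p | V.find p.1 = none} ∩ {p | some p.1 ∈ E}) ∪
          ⋃ i, ({p | V.find p.1 = some i} ∩ {_p | none ∈ E}) := by
      ext p
      cases hf : V.find p.1 with
      | none => simp [mtLoop_of_find_none V _ _ _ hf, hf]
      | some i => simp [mtLoop_zero_of_find_some V _ _ hf, hf]
    rw [this]
    exact (hnone.inter hE').union (MeasurableSet.iUnion fun i => (hsome i).inter (.const _))
  | succ K ih =>
    have : {p : (∀ k, Ω k) × (ℕ → ∀ k, Ω k) | (mtLoop V p.2 (K + 1) t p.1).result ∈ E} =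
        ({p | V.find p.1 = none} ∩ {p | some p.1 ∈ E}) ∪
          ⋃ i, ({p | V.find p.1 = some i} ∩
            (fun p : (∀ k, Ω k) × (ℕ → ∀ k, Ω k) => (resample (vbl (A i)) p.1 (p.2 t), p.2)) ⁻¹'
              {p | (mtLoop V p.2 K (t + 1) p.1).result ∈ E}) := by
      ext p
      cases hf : V.find p.1 with
      | none => simp [mtLoop_of_find_none V _ _ _ hf, hf]
      | some i => simp [mtLoop_succ_of_find_some V _ _ _ hf, hf]
    rw [this]
    refine (hnone.inter hE').union (MeasurableSet.iUnion fun i => (hsome i).inter ?_)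
    have hm : Measurable fun p : (∀ k, Ω k) × (ℕ → ∀ k, Ω k) =>
        (resample (vbl (A i)) p.1 (p.2 t), p.2) :=
      ((measurable_resample (vbl (A i))).comp
        (measurable_fst.prodMk ((measurable_pi_apply t).comp measurable_snd))).prodMk measurable_snd
    exact hm (ih (t + 1))

variable {μ : ∀ k, Measure (Ω k)} [∀ k, IsProbabilityMeasure (μ k)]

instance : IsProbabilityMeasure (sampleLaw μ) := by unfold sampleLaw; infer_instance

/-- Replacing sample `t` by an independent copy preserves the law, so this sample can be integrated
separately. -/
theorem sampleLaw_eq_lintegral {U : Set (ℕ → ∀ k, Ω k)} (hU : MeasurableSet U) (t : ℕ) :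
    sampleLaw μ U =
      ∫⁻ η, sampleLaw μ {ξ | Function.update ξ t η ∈ U} ∂Measure.pi μ := by
  have h := measurePreserving_update_infinitePi (Measure.pi μ) t
  have h1 : sampleLaw μ U = _ := (h.measure_preimage hU.nullMeasurableSet).symm
  rw [h1, Measure.prod_apply (h.measurable hU)]
  rfl

/-- The Markov property: this step consumes `ξ t`, and the remaining run reads later samples only.
-/
theorem sampleLaw_mtLoop_succ [Finite ι] {E : Set (Option (∀ k, Ω k))}
    (hE : MeasurableSet {ω | some ω ∈ E}) (K t : ℕ) {ω : ∀ k, Ω k} {i : ι}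
    (h : V.find ω = some i) :
    sampleLaw μ {ξ | (mtLoop V ξ (K + 1) t ω).result ∈ E} =
      refresh μ (vbl (A i))
        (fun ω' => sampleLaw μ {ξ | (mtLoop V ξ K (t + 1) ω').result ∈ E}) ω := by
  have hU : MeasurableSet {ξ | (mtLoop V ξ (K + 1) t ω).result ∈ E} :=
    measurable_prodMk_left (x := ω) (measurableSet_result_mtLoop V hE (K + 1) t)
  rw [sampleLaw_eq_lintegral hU t]
  refine lintegral_congr fun η => ?_
  congr 1
  ext ξ
  simp only [Set.mem_ofPred_eq, mtLoop_succ_of_find_some V _ _ _ h, Function.update_self]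
  rw [mtLoop_congr V K (t + 1) _ fun s hs => Function.update_of_ne (by omega) η ξ]

theorem sampleLaw_moserTardos [Finite ι] {E : Set (Option (∀ k, Ω k))}
    (hE : MeasurableSet {ω | some ω ∈ E}) (K : ℕ) :
    sampleLaw μ {ξ | (moserTardos V K ξ).result ∈ E} =
      ∫⁻ ω, sampleLaw μ {ξ | (mtLoop V ξ K 1 ω).result ∈ E} ∂Measure.pi μ := by
  have hm : Measurable fun ξ : ℕ → ∀ k, Ω k => (ξ 0, ξ) :=
    (measurable_pi_apply 0).prodMk measurable_id
  have hU : MeasurableSet {ξ | (moserTardos V K ξ).result ∈ E} :=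
    hm (measurableSet_result_mtLoop V hE K 1)
  rw [sampleLaw_eq_lintegral hU 0]
  refine lintegral_congr fun η => ?_
  congr 1
  ext ξ
  simp only [Set.mem_ofPred_eq, moserTardos, Function.update_self]
  rw [mtLoop_congr V K 1 _ fun s hs => Function.update_of_ne (by omega) η ξ]

/-- If `Φ ≥ 1` on `B` and `Φ` does not increase in expectation, then `Φ` bounds the probability that
the loop returns an assignment in `B`. -/
theorem sampleLaw_mtLoop_mem_le [Finite ι] {B : Set (∀ k, Ω k)} (hB : MeasurableSet B)
    {Φ : (∀ k, Ω k) → ℝ≥0∞} (hΦB : ∀ ω ∈ B, 1 ≤ Φ ω)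
    (hΦ : ∀ i ∈ S, ∀ ω ∈ A i, refresh μ (vbl (A i)) Φ ω ≤ Φ ω) (K t : ℕ) (ω : ∀ k, Ω k) :
    sampleLaw μ {ξ | (mtLoop V ξ K t ω).result ∈ some '' B} ≤ Φ ω := by
  have hE : MeasurableSet {ω | some ω ∈ some '' B} := by simpa using hB
  have hnone : ∀ (K t : ℕ) (ω), V.find ω = none →
      sampleLaw μ {ξ | (mtLoop V ξ K t ω).result ∈ some '' B} ≤ Φ ω := by
    intro K t ω hf
    by_cases hω : ω ∈ B
    · exact prob_le_one.trans (hΦB ω hω)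
    · simp [mtLoop_of_find_none V _ _ _ hf, hω]
  induction K generalizing t ω with
  | zero =>
    cases hf : V.find ω with
    | none => exact hnone _ _ _ hf
    | some i => simp [mtLoop_zero_of_find_some V _ _ hf]
  | succ K ih =>
    cases hf : V.find ω with
    | none => exact hnone _ _ _ hf
    | some i =>
      obtain ⟨hiS, hω⟩ := V.mem_of_find ω i hf
      rw [sampleLaw_mtLoop_succ V hE K t hf]
      exact (lintegral_mono fun η => ih (t + 1) _).trans (hΦ i hiS ω hω)

/-- If `Ψ k ≥ 1` does not increase in expectation, and decreases by a factor of `lam` when variable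
`k` is resampled, then long executions are unlikely. -/
theorem sampleLaw_mtLoop_none_mul_le [Finite ι] (hn : 0 < n)
    (hne : ∀ i ∈ S, (vbl (A i)).Nonempty) {lam : ℝ≥0∞} (hlam : 1 ≤ lam) (hlam' : lam ≠ ∞)
    {Ψ : Fin n → (∀ k, Ω k) → ℝ≥0∞} (hΨm : ∀ k, Measurable (Ψ k)) (hΨ1 : ∀ k ω, 1 ≤ Ψ k ω)
    (hΨ : ∀ k, ∀ i ∈ S, ∀ ω ∈ A i, refresh μ (vbl (A i)) (Ψ k) ω ≤ Ψ k ω)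
    (hΨlam : ∀ k, ∀ i ∈ S, k ∈ vbl (A i) →
      ∀ ω ∈ A i, lam * refresh μ (vbl (A i)) (Ψ k) ω ≤ Ψ k ω)
    (m K t : ℕ) (a : Fin n → ℕ) (hm : n * m ≤ K + ∑ k, a k) (ω : ∀ k, Ω k) :
    sampleLaw μ {ξ | (mtLoop V ξ K t ω).result = none} * lam ^ m ≤ ∑ k, lam ^ a k * Ψ k ω := by
  classical
  have hE : MeasurableSet {ω : ∀ k, Ω k | some ω ∈ ({none} : Set (Option (∀ k, Ω k)))} := by simp
  have hnone : ∀ (K t : ℕ) (ω), V.find ω = none →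
      sampleLaw μ {ξ | (mtLoop V ξ K t ω).result = none} = 0 := by
    intro K t ω hf
    simp [mtLoop_of_find_none V _ _ _ hf]
  induction K generalizing t ω a with
  | zero =>
    -- With no resampling left, the `n` counters add up to at least `n * m`, so one of them has
    -- reached `m`.
    obtain ⟨k, hk⟩ : ∃ k, m ≤ a k := by
      by_contra! hlt
      have : ∑ k, a k < ∑ _k : Fin n, m :=
        Finset.sum_lt_sum_of_nonempty ⟨⟨0, hn⟩, Finset.mem_univ _⟩ fun k _ => hlt k
      simp at this
      omega
    calc _ ≤ 1 * lam ^ m := mul_le_mul_left prob_le_one _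
      _ ≤ lam ^ a k * Ψ k ω := by
        rw [one_mul]
        exact (pow_le_pow_right₀ hlam hk).trans (le_mul_of_one_le_right zero_le (hΨ1 k ω))
      _ ≤ _ := Finset.single_le_sum (f := fun k => lam ^ a k * Ψ k ω) (fun _ _ => zero_le)
        (Finset.mem_univ k)
  | succ K ih =>
    cases hf : V.find ω with
    | none => simp [hnone _ _ _ hf]
    | some i =>
      obtain ⟨hiS, hω⟩ := V.mem_of_find ω i hf
      have hstep : sampleLaw μ {ξ | (mtLoop V ξ (K + 1) t ω).result = none} = _ :=
        sampleLaw_mtLoop_succ (μ := μ) V hE K t hf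
      -- The counter `a k` records how often variable `k` has been redrawn. The event found has a
      -- variable, so the sum of the counters grows by at least one while `K` drops by one.
      let a' : Fin n → ℕ := fun k => a k + if k ∈ vbl (A i) then 1 else 0
      have ha' : n * m ≤ K + ∑ k, a' k := by
        obtain ⟨k₀, hk₀⟩ := hne i hiS
        have h1 : 1 ≤ ∑ k, if k ∈ vbl (A i) then 1 else 0 := by
          have := Finset.single_le_sum (f := fun k => if k ∈ vbl (A i) then 1 else 0)
            (fun _ _ => Nat.zero_le _) (Finset.mem_univ k₀)
          simpa [hk₀] using this
        simp only [a', Finset.sum_add_distrib]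
        omega
      rw [hstep, refresh, ← lintegral_mul_const' _ _ (ENNReal.pow_ne_top hlam')]
      calc _ ≤ ∫⁻ η, ∑ k, lam ^ a' k * Ψ k (resample (vbl (A i)) ω η) ∂Measure.pi μ :=
            lintegral_mono fun η => ih (t + 1) a' ha' _
        _ = ∑ k, lam ^ a' k * refresh μ (vbl (A i)) (Ψ k) ω := by
            rw [lintegral_finsetSum]
            · refine Finset.sum_congr rfl fun k _ => ?_
              exact lintegral_const_mul _ ((hΨm k).comp (measurable_resample_right _ ω))
            · exact fun k _ => ((hΨm k).comp (measurable_resample_right _ ω)).const_mul _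
        _ ≤ ∑ k, lam ^ a k * Ψ k ω := by
            refine Finset.sum_le_sum fun k _ => ?_
            by_cases hk : k ∈ vbl (A i)
            · simp only [a', hk, if_true, pow_succ, mul_assoc]
              exact mul_le_mul_right (hΨlam k i hiS hk ω hω) _
            · simp only [a', hk, if_false, add_zero]
              exact mul_le_mul_right (hΨ k i hiS ω hω) _

end Loop

/-! ### Probability of a given outcome of the algorithm. -/

section Bounds

variable {n : ℕ} {Ω : Fin n → Type u} [∀ k, MeasurableSpace (Ω k)] {ι : Type v} [Fintype ι]
  {A : ι → Set (∀ k, Ω k)} {S : Finset ι}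
  {μ : ∀ k, Measure (Ω k)} [∀ k, IsProbabilityMeasure (μ k)] {y : ι → ℝ≥0∞}

theorem refresh_potential_le (hA : ∀ i, MeasurableSet (A i)) {R : Set (Fin n)} {lam : ℝ≥0∞}
    {h : (∀ k, Ω k) → ℝ≥0∞} (hh : Measurable h) (hlam : 1 ≤ lam)
    (hne : ∀ i ∈ S, (vbl (A i)).Nonempty)
    (hR : ∀ T : Set (Fin n), Disjoint T R → refresh μ T h = h) {i : ι} (hi : i ∈ S)
    {ω : ∀ k, Ω k} (hω : ω ∈ A i) :
    refresh μ (vbl (A i)) (potential μ A lam S R h) ω ≤ potential μ A lam S R h ω := by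
  classical
  refine le_trans (le_mul_of_one_le_left zero_le ?_)
    (mul_refresh_potential_le hA hh hlam (hne i hi) hi (fun hd => hR _ hd) hω)
  split_ifs
  exacts [le_rfl, hlam]

/-- The probability that the algorithm returns an assignment in `B`. -/
theorem sampleLaw_moserTardos_mem_le (V : Verifier A S) (hA : ∀ i, MeasurableSet (A i))
    (hne : ∀ i ∈ S, (vbl (A i)).Nonempty)
    (hy : ∀ i ∈ S, Measure.pi μ (A i) * ∏ j ∈ touching A S (vbl (A i)), (1 + y j) ≤ y i)
    {B : Set (∀ k, Ω k)} (hB : MeasurableSet B) (K : ℕ) :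
    sampleLaw μ {ξ | (moserTardos V K ξ).result ∈ some '' B} ≤
      Measure.pi μ B * ∏ j ∈ touching A S (vbl B), (1 + y j) := by
  have hE : MeasurableSet {ω | some ω ∈ some '' B} := by simpa using hB
  have hh : Measurable (B.indicator fun _ => (1 : ℝ≥0∞)) := measurable_const.indicator hB
  have hR : ∀ T : Set (Fin n), Disjoint T (vbl B) →
      refresh μ T (B.indicator fun _ => (1 : ℝ≥0∞)) = B.indicator fun _ => 1 := fun T hT => by
    rw [refresh_indicator (determinedBy_vbl B) hT.symm, refresh_one]
  rw [sampleLaw_moserTardos V hE]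
  calc _ ≤ ∫⁻ ω, potential μ A 1 S (vbl B) (B.indicator fun _ => 1) ω ∂Measure.pi μ := by
        refine lintegral_mono fun ω => sampleLaw_mtLoop_mem_le V hB (fun ω hω => ?_)
          (fun i hi ω hω => refresh_potential_le hA hh le_rfl hne hR hi hω) K 1 ω
        refine le_trans ?_ (le_potential ω)
        simp [hω]
    _ ≤ _ := by
        rw [lintegral_potential hA hh hne, lintegral_indicator_const hB, one_mul, mul_comm]
        simp only [one_mul]
        exact mul_le_mul_right ((tsum_layersWeight_le hy).trans sum_firstLayers_le) _

/-- The probability that the algorithm gives up. -/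
theorem sampleLaw_moserTardos_none_mul_le (V : Verifier A S) (hA : ∀ i, MeasurableSet (A i))
    (hn : 0 < n) (hne : ∀ i ∈ S, (vbl (A i)).Nonempty) {lam : ℝ≥0∞} (hlam : 1 ≤ lam)
    (hlam' : lam ≠ ∞)
    (hy : ∀ i ∈ S, lam * Measure.pi μ (A i) * ∏ j ∈ touching A S (vbl (A i)), (1 + y j) ≤ y i)
    {m K : ℕ} (hm : n * m ≤ K) :
    sampleLaw μ {ξ | (moserTardos V K ξ).result = none} * lam ^ m ≤
      ∑ k, (1 + ∑ j ∈ touching A S {k}, y j) := by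
  classical
  have hE : MeasurableSet {ω : ∀ k, Ω k | some ω ∈ ({none} : Set (Option (∀ k, Ω k)))} := by simp
  have hh : Measurable fun _ : ∀ k, Ω k => (1 : ℝ≥0∞) := measurable_const
  have hR : ∀ R T : Set (Fin n), Disjoint T R →
      refresh μ T (fun _ : ∀ k, Ω k => (1 : ℝ≥0∞)) = fun _ => 1 := fun _ _ _ => refresh_one
  have h0 : sampleLaw μ {ξ | (moserTardos V K ξ).result = none} = _ :=
    sampleLaw_moserTardos (μ := μ) V hE K
  rw [h0, ← lintegral_mul_const' _ _ (ENNReal.pow_ne_top hlam')]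
  calc _ ≤ ∫⁻ ω, ∑ k, lam ^ 0 * potential μ A lam S {k} (fun _ => 1) ω ∂Measure.pi μ := by
        refine lintegral_mono fun ω => sampleLaw_mtLoop_none_mul_le V hn hne hlam hlam'
          (Ψ := fun k => potential μ A lam S {k} fun _ => 1)
          (fun k => measurable_potential hA hh) (fun k ω => le_potential (h := fun _ => 1) ω)
          (fun k i hi ω hω => refresh_potential_le hA hh hlam hne (hR _) hi hω)
          (fun k i hi hk ω hω => ?_) m K 1 (fun _ => 0) (by simpa using hm) ω
        have := mul_refresh_potential_le (R := {k}) (μ := μ) hA hh hlam (hne i hi) hi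
          (fun hd => hR _ _ hd) hω
        rwa [if_neg (by simpa using hk)] at this
    _ ≤ _ := by
        simp only [pow_zero, one_mul]
        rw [lintegral_finsetSum _ fun k _ => measurable_potential hA hh]
        refine Finset.sum_le_sum fun k _ => ?_
        rw [lintegral_potential hA hh hne, lintegral_one, measure_univ, mul_one]
        exact (tsum_layersWeight_le hy).trans
          (add_le_add_right (sum_firstLayers_singleton_le k) 1)

end Bounds

/-! ### Consequences of the exponential slack. -/

section Slack

theorem eq_empty_or_univ_of_vbl_eq_empty {n : ℕ} {Ω : Fin n → Type u} {B : Set (∀ k, Ω k)} (h : vbl B = ∅) :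
    B = ∅ ∨ B = Set.univ := by
  rcases B.eq_empty_or_nonempty with hB | ⟨ω, hω⟩
  · exact Or.inl hB
  · refine Or.inr (Set.eq_univ_of_forall fun ω' => ?_)
    have := determinedBy_vbl B
    rw [h] at this
    exact (this ω ω' (by simp)).1 hω

variable {n : ℕ} {Ω : Fin n → Type u} [∀ k, MeasurableSpace (Ω k)] {ι : Type v} [Fintype ι]
  {A : ι → Set (∀ k, Ω k)} {μ : ∀ k, Measure (Ω k)} {ε : ℝ} {x : ι → ℝ}

theorem prob_nonneg (B : Set (∀ k, Ω k)) : 0 ≤ prob μ B := measureReal_nonneg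

namespace ExpSlack

theorem one_sub_pos (h : ExpSlack μ A ε x) (hε : 0 < ε) (i : ι) : 0 < 1 - x i := by
  linarith [h.lt i]

theorem prod_pos (h : ExpSlack μ A ε x) (hε : 0 < ε) (T : Finset ι) :
    0 < ∏ j ∈ T, (1 - x j) :=
  Finset.prod_pos fun j _ => h.one_sub_pos hε j

theorem prod_le_one (h : ExpSlack μ A ε x) (hε : 0 < ε) (T : Finset ι) :
    ∏ j ∈ T, (1 - x j) ≤ 1 :=
  Finset.prod_le_one (fun j _ => (h.one_sub_pos hε j).le) fun j _ => by linarith [h.pos j]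

theorem lllBound_pos (h : ExpSlack μ A ε x) (hε : 0 < ε) (i : ι) : 0 < lllBound A x i :=
  mul_pos (h.pos i) (h.prod_pos hε _)

theorem lllBound_le (h : ExpSlack μ A ε x) (hε : 0 < ε) (i : ι) : lllBound A x i ≤ x i :=
  mul_le_of_le_one_right (h.pos i).le (h.prod_le_one hε _)

/-- The events that depend on `k` are neighbours of each other. For any one of them, `δ` is at most
the product of `1 - x j` over the others, hence at most the exponential of minus their total weight.
The summand `1` pays for the chosen event. -/
theorem sum_touching_le (h : ExpSlack μ A ε x) (hε : 0 < ε) {Q : ℝ} (hQ : 0 ≤ Q)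
    (hδ : Real.log (1 / delta A x) ≤ Q) (k : Fin n) :
    ∑ j ∈ touching A Finset.univ {k}, x j ≤ 1 + Q := by
  classical
  rcases (touching A Finset.univ {k}).eq_empty_or_nonempty with he | ⟨i, hi⟩
  · rw [he, Finset.sum_empty]; linarith
  have hk : ∀ j ∈ touching A Finset.univ {k}, k ∈ vbl (A j) := fun j hj => by
    simpa using (Finset.mem_filter.1 hj).2
  have hsub : (touching A Finset.univ {k}).erase i ⊆ nbhd A i := fun j hj => by
    obtain ⟨hne, hj⟩ := Finset.mem_erase.1 hj
    exact Finset.mem_filter.2 ⟨Finset.mem_univ _, hne, k, hk j hj, hk i hi⟩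
  have : Nonempty ι := ⟨i⟩
  have hpos : 0 < delta A x := by
    obtain ⟨j, hj⟩ := exists_eq_ciInf_of_finite (f := lllBound A x)
    rw [delta, ← hj]
    exact h.lllBound_pos hε j
  have hle : delta A x ≤ Real.exp (-∑ j ∈ (touching A Finset.univ {k}).erase i, x j) := by
    calc delta A x ≤ lllBound A x i := ciInf_le (Set.finite_range _).bddBelow i
      _ ≤ 1 * ∏ j ∈ (touching A Finset.univ {k}).erase i, (1 - x j) := by
        refine mul_le_mul (by linarith [h.lt i]) ?_ (h.prod_pos hε _).le zero_le_one
        rw [← Finset.prod_sdiff hsub]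
        exact mul_le_of_le_one_left (h.prod_pos hε _).le (h.prod_le_one hε _)
      _ ≤ _ := by
        rw [one_mul, ← Finset.sum_neg_distrib, Real.exp_sum]
        refine Finset.prod_le_prod (fun j _ => (h.one_sub_pos hε j).le) fun j _ => ?_
        linarith [Real.add_one_le_exp (-x j)]
  have hlog := Real.log_le_log hpos hle
  rw [Real.log_exp] at hlog
  rw [one_div, Real.log_inv] at hδ
  rw [← Finset.add_sum_erase _ _ hi]
  linarith [h.lt i]

open Classical in
theorem sum_vbl_nonempty_le (h : ExpSlack μ A ε x) (hε : 0 < ε) {Q : ℝ} (hQ : 0 ≤ Q)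
    (hδ : Real.log (1 / delta A x) ≤ Q) :
    ∑ j with (vbl (A j)).Nonempty, x j ≤ n * (1 + Q) := by
  calc ∑ j with (vbl (A j)).Nonempty, x j
      ≤ ∑ k : Fin n, ∑ j ∈ touching A Finset.univ {k}, x j := by
        simp only [touching, Finset.sum_filter]
        rw [Finset.sum_comm]
        refine Finset.sum_le_sum fun j _ => ?_
        have hnn : ∀ k : Fin n, 0 ≤ if ¬ Disjoint (vbl (A j)) {k} then x j else 0 := fun k => by
          split_ifs
          exacts [le_rfl, (h.pos j).le]
        split_ifs with hj
        · obtain ⟨k, hk⟩ := hj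
          refine le_trans ?_ (Finset.single_le_sum (fun k _ => hnn k) (Finset.mem_univ k))
          rw [if_pos (by simpa using hk)]
        · exact Finset.sum_nonneg fun k _ => hnn k
    _ ≤ ∑ _k : Fin n, (1 + Q) := Finset.sum_le_sum fun k _ => h.sum_touching_le hε hQ hδ k
    _ = n * (1 + Q) := by
        rw [Finset.sum_const, Finset.card_fin, nsmul_eq_mul]

/-- The weights of the layerings: `1 + odds x i = 1 / (1 - x i)`. -/
noncomputable def odds (x : ι → ℝ) (i : ι) : ℝ≥0∞ := ENNReal.ofReal (x i / (1 - x i))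

theorem prod_one_add_odds (h : ExpSlack μ A ε x) (hε : 0 < ε) (T : Finset ι) :
    ∏ j ∈ T, (1 + odds x j) = ENNReal.ofReal (∏ j ∈ T, (1 - x j)⁻¹) := by
  rw [ENNReal.ofReal_prod_of_nonneg fun j _ => (inv_pos.2 (h.one_sub_pos hε j)).le]
  refine Finset.prod_congr rfl fun j _ => ?_
  have h1 := h.one_sub_pos hε j
  rw [odds, ← ENNReal.ofReal_one, ← ENNReal.ofReal_add zero_le_one (div_pos (h.pos j) h1).le]
  congr 1
  field_simp
  ring

theorem prod_inv_mono (h : ExpSlack μ A ε x) (hε : 0 < ε) {T T' : Finset ι} (hT : T ⊆ T') :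
    ∏ j ∈ T, (1 - x j)⁻¹ ≤ ∏ j ∈ T', (1 - x j)⁻¹ :=
  Finset.prod_le_prod_of_subset_of_one_le hT
    (fun j _ => (inv_pos.2 (h.one_sub_pos hε j)).le)
    fun j _ _ => (one_le_inv₀ (h.one_sub_pos hε j)).2 (by linarith [h.pos j])

theorem prob_le_mul_rpow (h : ExpSlack μ A ε x) (hε : 0 < ε) (hε1 : ε < 1) (i : ι) :
    prob μ (A i) ≤ lllBound A x i * prob μ (A i) ^ ε := by
  calc prob μ (A i) = prob μ (A i) ^ (1 - ε) * prob μ (A i) ^ ε := by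
        rw [← Real.rpow_add_of_nonneg (prob_nonneg _) (by linarith) hε.le]
        simp
    _ ≤ _ := mul_le_mul_of_nonneg_right (h.bound i) (Real.rpow_nonneg (prob_nonneg _) _)

variable [∀ k, IsProbabilityMeasure (μ k)]

theorem prob_le_lllBound (h : ExpSlack μ A ε x) (hε : 0 < ε) (hε1 : ε < 1) (i : ι) :
    prob μ (A i) ≤ lllBound A x i :=
  (h.prob_le_mul_rpow hε hε1 i).trans (mul_le_of_le_one_right (h.lllBound_pos hε i).le
    (Real.rpow_le_one (prob_nonneg _) measureReal_le_one hε.le))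

/-- The probability is at most `x i < 1 - ε ≤ exp (-ε)`, so the spare factor `prob μ (A i) ^ ε` is
at most `exp (-ε ^ 2)`. -/
theorem exp_mul_prob_le (h : ExpSlack μ A ε x) (hε : 0 < ε) (hε1 : ε < 1) (i : ι) :
    Real.exp (ε ^ 2) * prob μ (A i) ≤ lllBound A x i := by
  have h1 : prob μ (A i) ≤ Real.exp (-ε) := by
    have := Real.add_one_le_exp (-ε)
    linarith [h.prob_le_lllBound hε hε1 i, h.lllBound_le hε i, h.lt i]
  have h2 : prob μ (A i) ^ ε ≤ Real.exp (-ε ^ 2) := by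
    refine (Real.rpow_le_rpow (prob_nonneg _) h1 hε.le).trans_eq ?_
    rw [← Real.exp_mul]
    ring_nf
  calc Real.exp (ε ^ 2) * prob μ (A i)
      ≤ Real.exp (ε ^ 2) * (lllBound A x i * Real.exp (-ε ^ 2)) := by
        refine mul_le_mul_of_nonneg_left ((h.prob_le_mul_rpow hε hε1 i).trans ?_)
          (Real.exp_pos _).le
        exact mul_le_mul_of_nonneg_left h2 (h.lllBound_pos hε i).le
    _ = lllBound A x i * Real.exp (ε ^ 2 + -ε ^ 2) := by rw [Real.exp_add]; ring
    _ = lllBound A x i := by simp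

/-- An event without variables is impossible or certain, and certainty contradicts the bound `x i <
1 - ε` on its probability. -/
theorem vbl_nonempty (h : ExpSlack μ A ε x) (hε : 0 < ε) (hε1 : ε < 1) {i : ι}
    (hi : 0 < prob μ (A i)) : (vbl (A i)).Nonempty := by
  by_contra hne
  rcases eq_empty_or_univ_of_vbl_eq_empty (Set.not_nonempty_iff_eq_empty.1 hne) with he | he
  · simp [he, prob] at hi
  · have h1 := h.prob_le_lllBound hε hε1 i
    have h2 := h.lllBound_le hε i
    have h3 := h.lt i
    simp only [prob, he, probReal_univ] at h1
    linarith

/-- There are few events of large probability. -/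
theorem card_core_mul_le (h : ExpSlack μ A ε x) (hε : 0 < ε) (hε1 : ε < 1) {Q : ℝ} (hQ : 0 ≤ Q)
    (hδ : Real.log (1 / delta A x) ≤ Q) {p : ℝ} (hp : 0 < p) :
    (core μ A p).card * p ≤ n * (1 + Q) := by
  classical
  have hcore : ∀ i ∈ core μ A p, p ≤ prob μ (A i) := fun i hi => (Finset.mem_filter.1 hi).2
  calc (core μ A p).card * p ≤ ∑ j ∈ core μ A p, x j := by
        rw [← nsmul_eq_mul]
        exact Finset.card_nsmul_le_sum _ _ _ fun i hi => (hcore i hi).trans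
          ((h.prob_le_lllBound hε hε1 i).trans (h.lllBound_le hε i))
    _ ≤ ∑ j with (vbl (A j)).Nonempty, x j :=
        Finset.sum_le_sum_of_subset_of_nonneg (fun i hi => Finset.mem_filter.2
          ⟨Finset.mem_univ _, h.vbl_nonempty hε hε1 (hp.trans_le (hcore i hi))⟩)
          fun j _ _ => (h.pos j).le
    _ ≤ _ := h.sum_vbl_nonempty_le hε hQ hδ

/-- The neighbours cancel the product in `lllBound`. The event may also touch itself, and its own
factor `(1 - x i)⁻¹` turns `x i` into the odds. -/
theorem exp_mul_measure_mul_prod_le (h : ExpSlack μ A ε x) (hε : 0 < ε) (hε1 : ε < 1)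
    (S : Finset ι) (i : ι) :
    ENNReal.ofReal (Real.exp (ε ^ 2)) * Measure.pi μ (A i) *
      ∏ j ∈ touching A S (vbl (A i)), (1 + odds x j) ≤ odds x i := by
  classical
  have hsub : touching A S (vbl (A i)) ⊆ insert i (nbhd A i) := fun j hj => by
    rw [Finset.mem_insert, or_iff_not_imp_left]
    exact fun hne => Finset.mem_filter.2 ⟨Finset.mem_univ _, hne,
      Set.not_disjoint_iff_nonempty_inter.1 (Finset.mem_filter.1 hj).2⟩
  have h1 := h.one_sub_pos hε i
  have hN := h.prod_pos hε (nbhd A i)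
  rw [h.prod_one_add_odds hε, ← ofReal_measureReal, ← ENNReal.ofReal_mul (Real.exp_pos _).le,
    ← ENNReal.ofReal_mul (mul_nonneg (Real.exp_pos _).le measureReal_nonneg)]
  refine ENNReal.ofReal_le_ofReal ?_
  have hi : i ∉ nbhd A i := fun hi => (Finset.mem_filter.1 hi).2.1 rfl
  calc _ ≤ lllBound A x i * ((1 - x i)⁻¹ * (∏ j ∈ nbhd A i, (1 - x j))⁻¹) := by
        rw [← Finset.prod_inv_distrib, ← Finset.prod_insert (f := fun j => (1 - x j)⁻¹) hi]
        exact mul_le_mul (h.exp_mul_prob_le hε hε1 i) (h.prod_inv_mono hε hsub)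
          (Finset.prod_nonneg fun j _ => (inv_pos.2 (h.one_sub_pos hε j)).le)
          (h.lllBound_pos hε i).le
    _ = x i / (1 - x i) := by
        rw [lllBound]
        field_simp

theorem measure_mul_prod_le (h : ExpSlack μ A ε x) (hε : 0 < ε) (hε1 : ε < 1)
    (S : Finset ι) (i : ι) :
    Measure.pi μ (A i) * ∏ j ∈ touching A S (vbl (A i)), (1 + odds x j) ≤ odds x i := by
  refine le_trans ?_ (h.exp_mul_measure_mul_prod_le hε hε1 S i)
  rw [mul_assoc]
  exact le_mul_of_one_le_left zero_le (ENNReal.one_le_ofReal.2 (Real.one_le_exp (sq_nonneg _)))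

/-- A bad event outside of the core is unlikely to hold in the assignment that is returned. -/
theorem real_moserTardos_mem_le (h : ExpSlack μ A ε x) (hε : 0 < ε) (hε1 : ε < 1)
    (hA : ∀ i, MeasurableSet (A i)) {p : ℝ} (hp : 0 < p) (V : Verifier A (core μ A p)) (K : ℕ)
    {i : ι} (hi : i ∉ core μ A p) :
    (sampleLaw μ).real {ξ | (moserTardos V K ξ).result ∈ some '' A i} ≤ x i * p ^ ε := by
  classical
  have hne : ∀ j ∈ core μ A p, (vbl (A j)).Nonempty := fun j hj =>
    h.vbl_nonempty hε hε1 (hp.trans_le (Finset.mem_filter.1 hj).2)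
  have hip : prob μ (A i) ≤ p := by
    simp only [core, Finset.mem_filter, Finset.mem_univ, true_and, not_le] at hi
    exact hi.le
  -- Being outside the core, `i` is not among the touching events, so the bound is `x i` rather than
  -- the odds.
  have hsub : touching A (core μ A p) (vbl (A i)) ⊆ nbhd A i := fun j hj => by
    obtain ⟨hj1, hj2⟩ := Finset.mem_filter.1 hj
    exact Finset.mem_filter.2 ⟨Finset.mem_univ _, fun he => hi (he ▸ hj1),
      Set.not_disjoint_iff_nonempty_inter.1 hj2⟩
  have hN := h.prod_pos hε (nbhd A i)
  have hb := h.lllBound_pos hε i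
  have key := sampleLaw_moserTardos_mem_le V hA hne
    (fun j _ => h.measure_mul_prod_le hε hε1 (core μ A p) j) (hA i) K
  rw [h.prod_one_add_odds hε, ← ofReal_measureReal, ← ofReal_measureReal,
    ← ENNReal.ofReal_mul measureReal_nonneg, ENNReal.ofReal_le_ofReal_iff
      (mul_nonneg measureReal_nonneg
        (Finset.prod_nonneg fun j _ => (inv_pos.2 (h.one_sub_pos hε j)).le))] at key
  refine key.trans ?_
  calc _ ≤ (lllBound A x i * p ^ ε) * ∏ j ∈ nbhd A i, (1 - x j)⁻¹ := by
        refine mul_le_mul ((h.prob_le_mul_rpow hε hε1 i).trans ?_) (h.prod_inv_mono hε hsub)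
          (Finset.prod_nonneg fun j _ => (inv_pos.2 (h.one_sub_pos hε j)).le)
          (mul_nonneg hb.le (Real.rpow_nonneg hp.le _))
        exact mul_le_mul_of_nonneg_left (Real.rpow_le_rpow (prob_nonneg _) hip hε.le) hb.le
    _ = x i * p ^ ε := by
        rw [lllBound, Finset.prod_inv_distrib]
        field_simp

/-- Exponential tail of the number of resamplings. -/
theorem real_moserTardos_none_mul_le (h : ExpSlack μ A ε x) (hε : 0 < ε) (hε1 : ε < 1)
    (hA : ∀ i, MeasurableSet (A i)) (hn : 0 < n) {Q : ℝ} (hQ : 0 ≤ Q)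
    (hδ : Real.log (1 / delta A x) ≤ Q) {p : ℝ} (hp : 0 < p) (V : Verifier A (core μ A p))
    {m K : ℕ} (hm : n * m ≤ K) :
    (sampleLaw μ).real {ξ | (moserTardos V K ξ).result = none} * Real.exp (m * ε ^ 2) ≤
      n * (1 + (1 + Q) / ε) := by
  classical
  have hne : ∀ j ∈ core μ A p, (vbl (A j)).Nonempty := fun j hj =>
    h.vbl_nonempty hε hε1 (hp.trans_le (Finset.mem_filter.1 hj).2)
  have key := sampleLaw_moserTardos_none_mul_le V hA hn hne
    (ENNReal.one_le_ofReal.2 (Real.one_le_exp (sq_nonneg ε))) ENNReal.ofReal_ne_top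
    (fun j _ => h.exp_mul_measure_mul_prod_le hε hε1 (core μ A p) j) hm
  rw [← ENNReal.ofReal_pow (Real.exp_pos _).le, ← Real.exp_nat_mul, ← ofReal_measureReal,
    ← ENNReal.ofReal_mul measureReal_nonneg] at key
  rw [← ENNReal.ofReal_le_ofReal_iff (by positivity)]
  refine key.trans ?_
  calc _ ≤ ∑ _k : Fin n, ENNReal.ofReal (1 + (1 + Q) / ε) := by
        refine Finset.sum_le_sum fun k _ => ?_
        rw [ENNReal.ofReal_add zero_le_one (by positivity), ENNReal.ofReal_one]
        refine add_le_add le_rfl ?_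
        unfold odds
        rw [← ENNReal.ofReal_sum_of_nonneg
          fun j _ => (div_pos (h.pos j) (h.one_sub_pos hε j)).le]
        refine ENNReal.ofReal_le_ofReal ?_
        calc _ ≤ ∑ j ∈ touching A Finset.univ {k}, x j / (1 - x j) :=
              Finset.sum_le_sum_of_subset_of_nonneg
                (Finset.filter_subset_filter _ (Finset.subset_univ _))
                fun j _ _ => (div_pos (h.pos j) (h.one_sub_pos hε j)).le
          _ ≤ ∑ j ∈ touching A Finset.univ {k}, x j / ε :=
              Finset.sum_le_sum fun j _ =>
                div_le_div_of_nonneg_left (h.pos j).le hε (by linarith [h.lt j])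
          _ ≤ (1 + Q) / ε := by
              rw [← Finset.sum_div]
              exact div_le_div_of_nonneg_right (h.sum_touching_le hε hQ hδ k) hε.le
    _ = _ := by
        rw [Finset.sum_const, Finset.card_fin, nsmul_eq_mul, ENNReal.ofReal_mul (Nat.cast_nonneg n),
          ENNReal.ofReal_natCast]

end ExpSlack

end Slack

/-! ### Numerical estimates. -/

/-- Every polynomial with natural coefficients is bounded by a power for arguments `≥ 2`. -/
theorem exists_eval_add_two_le_pow (q : Polynomial ℕ) :
    ∃ d : ℕ, ∀ n : ℕ, 2 ≤ n → q.eval n + 2 ≤ n ^ d := by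
  -- `q.eval 1` is the sum of the coefficients; as `a < n ^ a` for `n ≥ 2`, the constant factor
  -- moves into the exponent.
  refine ⟨q.eval 1 + 2 + q.natDegree, fun n hn => ?_⟩
  have h1 : q.eval n ≤ q.eval 1 * n ^ q.natDegree := by
    rw [Polynomial.eval_eq_sum_range, Polynomial.eval_eq_sum_range, Finset.sum_mul]
    refine Finset.sum_le_sum fun i hi => ?_
    rw [one_pow, mul_one]
    exact Nat.mul_le_mul_left _ (Nat.pow_le_pow_right (by omega)
      (Nat.lt_succ_iff.1 (Finset.mem_range.1 hi)))
  have h2 : 1 ≤ n ^ q.natDegree := Nat.one_le_pow _ _ (by omega)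
  calc q.eval n + 2 ≤ (q.eval 1 + 2) * n ^ q.natDegree := by nlinarith
    _ ≤ n ^ (q.eval 1 + 2) * n ^ q.natDegree :=
        Nat.mul_le_mul_right _ (Nat.lt_pow_self hn).le
    _ = _ := (pow_add _ _ _).symm

theorem resamplingBound_nonneg {C ε : ℝ} (hC : 0 ≤ C) {n : ℕ} (hn : 0 < n) (hε : 0 < ε)
    (hε1 : ε < 1) : 0 ≤ resamplingBound C n ε := by
  have h1 : (1 : ℝ) ≤ n := by exact_mod_cast hn
  have h2 : 1 ≤ (n : ℝ) / ε ^ 2 := by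
    rw [one_le_div (by positivity)]
    nlinarith
  exact mul_nonneg (by positivity) (Real.log_nonneg h2)

/-- The exponential tail after `⌊resamplingBound C n ε⌋` resamplings. -/
theorem rpow_div_le_exp {C ε : ℝ} (hC : 1 ≤ C) {n : ℕ} (hn : 0 < n) (hε : 0 < ε) (hε1 : ε < 1) :
    (n : ℝ) ^ C / ε ≤
      8 * Real.exp ((⌊resamplingBound C n ε⌋₊ / n : ℕ) * ε ^ 2) := by
  have hn0 : (0 : ℝ) < n := by exact_mod_cast hn
  have hn1 : (1 : ℝ) ≤ n := by exact_mod_cast hn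
  set K := ⌊resamplingBound C n ε⌋₊
  set m := K / n
  have hK : resamplingBound C n ε < K + 1 := Nat.lt_floor_add_one _
  have hm : (K : ℝ) + 1 ≤ n * (m + 1) := by
    have : K + 1 ≤ n * (m + 1) := Nat.lt_mul_div_succ K hn
    exact_mod_cast this
  have hε2 : ε ^ 2 ≤ 1 := by nlinarith
  have hlogε : 0 ≤ -Real.log ε := by linarith [Real.log_nonpos hε.le hε1.le]
  have hlog : Real.log ((n : ℝ) / ε ^ 2) = Real.log n + 2 * -Real.log ε := by
    rw [Real.log_div hn0.ne' (by positivity), Real.log_pow]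
    push_cast
    ring
  have h1 : C * Real.log ((n : ℝ) / ε ^ 2) ≤ (m + 1) * ε ^ 2 := by
    have h2 : resamplingBound C n ε = n * (C * Real.log ((n : ℝ) / ε ^ 2)) / ε ^ 2 := by
      rw [resamplingBound]; ring
    have h3 := hK.le.trans hm
    rw [h2, div_le_iff₀ (by positivity), mul_assoc] at h3
    exact le_of_mul_le_mul_left h3 hn0
  -- The floor and the division by `n` together cost at most one in `m`, that is, at most `1` in the
  -- exponent since `ε ^ 2 ≤ 1`; the factor `8` covers `exp 1`.
  have h2 : C * Real.log n - Real.log ε ≤ m * ε ^ 2 + 1 := by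
    rw [hlog] at h1
    nlinarith
  have h3 : (n : ℝ) ^ C / ε = Real.exp (C * Real.log n - Real.log ε) := by
    rw [Real.exp_sub, Real.exp_log hε, Real.rpow_def_of_pos hn0, mul_comm]
  rw [h3]
  calc _ ≤ Real.exp (m * ε ^ 2 + 1) := Real.exp_le_exp.2 h2
    _ = Real.exp 1 * Real.exp (m * ε ^ 2) := by rw [Real.exp_add, mul_comm]
    _ ≤ _ := mul_le_mul_of_nonneg_right (by linarith [Real.exp_one_lt_d9]) (Real.exp_pos _).le

/-! ### The guarantees of the truncated algorithm. -/

section Main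

variable {n : ℕ} {Ω : Fin n → Type u} [∀ k, MeasurableSpace (Ω k)] {ι : Type v}
  {A : ι → Set (∀ k, Ω k)}

theorem moserTardos_le {S : Finset ι} (V : Verifier A S) {τ : ℕ} (hτ : ∀ ω, V.cost ω ≤ τ)
    {R : ℝ} (hR : 0 ≤ R) (ξ : ℕ → ∀ k, Ω k) :
    ((moserTardos V ⌊R⌋₊ ξ).resamplings : ℝ) ≤ R ∧
      ((moserTardos V ⌊R⌋₊ ξ).steps : ℝ) ≤ (R + 1) * ((n : ℝ) + (τ : ℝ)) := by
  have hK := Nat.floor_le hR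
  constructor
  · exact le_trans (by exact_mod_cast resamplings_mtLoop_le V ξ ⌊R⌋₊ 1 (ξ 0)) hK
  · have h1 : (moserTardos V ⌊R⌋₊ ξ).steps ≤ (⌊R⌋₊ + 1) * (n + τ) := by
      have := steps_mtLoop_le V hτ ξ ⌊R⌋₊ 1 (ξ 0)
      simp only [moserTardos]
      linarith
    have h2 : ((moserTardos V ⌊R⌋₊ ξ).steps : ℝ) ≤ (⌊R⌋₊ + 1) * ((n : ℝ) + τ) := by
      exact_mod_cast h1
    exact h2.trans (by gcongr)

/-- An execution that returns no good assignment either gives up or returns an assignment in which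
an event outside of the core holds. -/
theorem one_le_real_good_add [Fintype ι] [DecidableEq ι] {μ : ∀ k, Measure (Ω k)}
    [∀ k, IsProbabilityMeasure (μ k)] {S : Finset ι} (V : Verifier A S) (K : ℕ) :
    1 ≤ (sampleLaw μ).real {ξ | ∃ ω, (moserTardos V K ξ).result = some ω ∧ Good A ω} +
      ((sampleLaw μ).real {ξ | (moserTardos V K ξ).result = none} +
        ∑ i ∈ Sᶜ, (sampleLaw μ).real {ξ | (moserTardos V K ξ).result ∈ some '' A i}) := by
  have hcover : (Set.univ : Set (ℕ → ∀ k, Ω k)) ⊆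
      {ξ | ∃ ω, (moserTardos V K ξ).result = some ω ∧ Good A ω} ∪
        ({ξ | (moserTardos V K ξ).result = none} ∪
          ⋃ i ∈ Sᶜ, {ξ | (moserTardos V K ξ).result ∈ some '' A i}) := by
    intro ξ _
    cases hr : (moserTardos V K ξ).result with
    | none => exact Or.inr (Or.inl hr)
    | some ω =>
      by_cases hg : Good A ω
      · exact Or.inl ⟨ω, hr, hg⟩
      · simp only [Good, not_forall, not_not] at hg
        obtain ⟨i, hi⟩ := hg
        have hiS : i ∉ S := fun hiS =>
          V.notMem_of_find ω (find_eq_none_of_result_mtLoop V ξ K 1 (ξ 0) hr) i hiS hi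
        refine Or.inr (Or.inr ?_)
        simp only [Set.mem_iUnion]
        exact ⟨i, Finset.mem_compl.2 hiS, ω, hi, hr.symm⟩
  -- Only monotonicity and subadditivity are used, so the set of good runs need not be shown
  -- measurable.
  calc (1 : ℝ) = (sampleLaw μ).real Set.univ := probReal_univ.symm
    _ ≤ _ := measureReal_mono hcover
    _ ≤ _ := measureReal_union_le _ _
    _ ≤ _ := add_le_add_right ((measureReal_union_le _ _).trans
        (add_le_add_right (measureReal_biUnion_finset_le _ _) _)) _

/-- Failure means giving up or returning an assignment in which an event outside the core holds;
each receives half of `n ^ (-c)`. -/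
theorem ExpSlack.one_sub_rpow_le [Fintype ι] {μ : ∀ k, Measure (Ω k)}
    [∀ k, IsProbabilityMeasure (μ k)] {ε : ℝ} {x : ι → ℝ} (h : ExpSlack μ A ε x) (hε : 0 < ε)
    (hε1 : ε < 1) (hA : ∀ i, MeasurableSet (A i)) (hn : 0 < n) {Q c : ℝ} {d : ℕ} (hQ : 0 ≤ Q)
    (hc : 0 < c) (hQd : 2 ≤ n → Q + 2 ≤ (n : ℝ) ^ d)
    (hδ : Real.log (1 / delta A x) ≤ Q) {p : ℝ} (hp : 0 < p)
    (hpn : p ≤ (n : ℝ) ^ (-((c + d + 5) / ε))) (V : Verifier A (core μ A p)) :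
    1 - (n : ℝ) ^ (-c) ≤ (sampleLaw μ).real {ξ | ∃ ω,
      (moserTardos V ⌊resamplingBound (c + d + 5) n ε⌋₊ ξ).result = some ω ∧ Good A ω} := by
  classical
  -- For `n = 1` the claimed lower bound is `0`.
  rcases Nat.lt_or_ge n 2 with hn2 | hn2
  · obtain rfl : n = 1 := by omega
    simp
  set C : ℝ := c + d + 5
  set K := ⌊resamplingBound C n ε⌋₊
  have hn0 : (0 : ℝ) < n := by exact_mod_cast hn
  have hn2' : (2 : ℝ) ≤ n := by exact_mod_cast hn2
  replace hQd := hQd hn2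
  have hC1 : 1 ≤ C := by
    have : (0 : ℝ) ≤ d := Nat.cast_nonneg d
    simp only [C]; linarith
  have hhalf : (n : ℝ) ^ (-c - 1) ≤ (n : ℝ) ^ (-c) / 2 := by
    rw [Real.rpow_sub_one hn0.ne']
    exact div_le_div_of_nonneg_left (Real.rpow_nonneg hn0.le _) two_pos hn2'
  -- The budget of `C = c + d + 5`: `1` for the number of variables, `d` for `Q + 2`, `3` for the
  -- constant `8`, and `1` for the halving in `hhalf`.
  have hpow : (n : ℝ) ^ (-c - 1) = (n : ℝ) ^ (-C) * (n * n ^ d * n ^ 3) := by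
    have : (n : ℝ) * n ^ d * n ^ 3 = (n : ℝ) ^ ((d : ℝ) + 4) := by
      rw [Real.rpow_add hn0, Real.rpow_natCast]
      norm_cast
      ring
    rw [this, ← Real.rpow_add hn0]
    congr 1
    simp only [C]; ring
  have hn3 : (8 : ℝ) ≤ n ^ 3 := by
    calc (8 : ℝ) = 2 ^ 3 := by norm_num
      _ ≤ _ := pow_le_pow_left₀ zero_le_two hn2' 3
  have hnone : (sampleLaw μ).real {ξ | (moserTardos V K ξ).result = none} ≤
      (n : ℝ) ^ (-c - 1) := by
    have h1 := h.real_moserTardos_none_mul_le hε hε1 hA hn hQ hδ hp V (Nat.mul_div_le K n)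
    have h2 := rpow_div_le_exp hC1 hn hε hε1
    set P := (sampleLaw μ).real {ξ | (moserTardos V K ξ).result = none}
    have hP : 0 ≤ P := measureReal_nonneg
    have h3 : P * ((n : ℝ) ^ C / ε) ≤ 8 * (n * ((Q + 2) / ε)) := by
      calc _ ≤ P * (8 * Real.exp ((K / n : ℕ) * ε ^ 2)) := mul_le_mul_of_nonneg_left h2 hP
        _ = 8 * (P * Real.exp ((K / n : ℕ) * ε ^ 2)) := by ring
        _ ≤ 8 * (n * (1 + (1 + Q) / ε)) := by gcongr
        _ ≤ _ := by
          have : 1 + (1 + Q) / ε ≤ (Q + 2) / ε := by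
            rw [← sub_nonneg]
            have : (Q + 2) / ε - (1 + (1 + Q) / ε) = (1 - ε) / ε := by field_simp; ring
            rw [this]
            exact div_nonneg (by linarith) hε.le
          gcongr
    have h4 : P * (n : ℝ) ^ C ≤ n ^ 3 * (n * n ^ d) := by
      have h5 : P * (n : ℝ) ^ C ≤ 8 * (n * (Q + 2)) := by
        have h6 := mul_le_mul_of_nonneg_right h3 hε.le
        calc _ = P * ((n : ℝ) ^ C / ε) * ε := by field_simp
          _ ≤ _ := h6
          _ = _ := by field_simp
      exact h5.trans (by gcongr)
    rw [hpow]
    calc P = (n : ℝ) ^ (-C) * (P * (n : ℝ) ^ C) := by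
          rw [Real.rpow_neg hn0.le]
          field_simp
      _ ≤ (n : ℝ) ^ (-C) * (n ^ 3 * (n * n ^ d)) := by gcongr
      _ = _ := by ring
  have hbad : ∑ i ∈ (core μ A p)ᶜ,
      (sampleLaw μ).real {ξ | (moserTardos V K ξ).result ∈ some '' A i} ≤
      (n : ℝ) ^ (-c - 1) := by
    -- The `1 / ε` in the exponent of the threshold is there to cancel this `ε`.
    have hpε : p ^ ε ≤ (n : ℝ) ^ (-C) := by
      refine (Real.rpow_le_rpow hp.le hpn hε.le).trans_eq ?_
      rw [← Real.rpow_mul hn0.le]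
      congr 1
      field_simp
    -- Events without variables have to be dropped: their number, and so their total weight, is not
    -- controlled by `δ`, but they are empty sets.
    calc _ ≤ ∑ i ∈ (core μ A p)ᶜ, if (vbl (A i)).Nonempty then x i * p ^ ε else 0 := by
          refine Finset.sum_le_sum fun i hi => ?_
          split_ifs with hne
          · exact h.real_moserTardos_mem_le hε hε1 hA hp V K (Finset.mem_compl.1 hi)
          · have : A i = ∅ := by
              rcases eq_empty_or_univ_of_vbl_eq_empty (Set.not_nonempty_iff_eq_empty.1 hne)
                with he | he
              · exact he
              · exact absurd (h.vbl_nonempty hε hε1 (by simp [prob, he])) hne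
            simp [this]
      _ ≤ ∑ i, if (vbl (A i)).Nonempty then x i * p ^ ε else 0 := by
          refine Finset.sum_le_sum_of_subset_of_nonneg (Finset.subset_univ _) fun i _ _ => ?_
          split_ifs
          exacts [mul_nonneg (h.pos i).le (Real.rpow_nonneg hp.le _), le_rfl]
      _ = (∑ i with (vbl (A i)).Nonempty, x i) * p ^ ε := by
          rw [← Finset.sum_filter, Finset.sum_mul]
      _ ≤ (n * (1 + Q)) * (n : ℝ) ^ (-C) := by
          have := h.sum_vbl_nonempty_le hε hQ hδ
          gcongr
      _ ≤ _ := by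
          rw [hpow, mul_comm]
          have h1 : 1 + Q ≤ (n : ℝ) ^ d := by linarith
          have h2 : (n : ℝ) * (1 + Q) ≤ n * n ^ d * 1 := by rw [mul_one]; gcongr
          refine mul_le_mul_of_nonneg_left (h2.trans ?_) (Real.rpow_nonneg hn0.le _)
          gcongr
          linarith
  have := one_le_real_good_add (μ := μ) V K
  linarith

end Main

end LLL

theorem theorem3p4 (q : Polynomial ℕ) (c : ℝ) (hc : 0 < c) :
    ∃ C D : ℝ, 0 < C ∧ 0 < D ∧ ∀ s : Polynomial ℕ, ∃ r : Polynomial ℕ,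
      ∀ (n : ℕ) (_ : 0 < n) (Ω : Fin n → Type*) [∀ k, MeasurableSpace (Ω k)]
        (μ : ∀ k, Measure (Ω k)) [∀ k, IsProbabilityMeasure (μ k)]
        (ι : Type*) [Fintype ι] (A : ι → Set (∀ k, Ω k)) (_ : ∀ i, MeasurableSet (A i))
        (ε : ℝ) (_ : 0 < ε) (_ : ε < 1) (x : ι → ℝ) (_ : LLL.ExpSlack μ A ε x)
        (_ : Real.log (1 / LLL.delta A x) ≤ (q.eval n : ℕ)),
        -- there are only polynomially many events of probability at least `1 / s(n)`
        (∀ p : ℝ, 0 < s.eval n → 1 / ((s.eval n : ℕ) : ℝ) ≤ p →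
          (LLL.core μ A p).card ≤ r.eval n) ∧
        -- the truncated algorithm on the core at any threshold up to `n ^ (- D / ε)`
        (∀ p : ℝ, 0 < p → p ≤ (n : ℝ) ^ (-(D / ε)) →
          ∀ (V : LLL.Verifier A (LLL.core μ A p)) (τ : ℕ) (_ : ∀ ω, V.cost ω ≤ τ) (K : ℕ)
            (_ : K = ⌊LLL.resamplingBound C n ε⌋₊),
            (∀ ξ : ℕ → ∀ k, Ω k,
              ((LLL.moserTardos V K ξ).resamplings : ℝ) ≤ LLL.resamplingBound C n ε ∧
              ((LLL.moserTardos V K ξ).steps : ℝ) ≤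
                (LLL.resamplingBound C n ε + 1) * ((n : ℝ) + (τ : ℝ))) ∧
            1 - (n : ℝ) ^ (-c) ≤
              (LLL.sampleLaw μ).real
                {ξ | ∃ ω, (LLL.moserTardos V K ξ).result = some ω ∧ LLL.Good A ω}) := by
  obtain ⟨d, hd⟩ := LLL.exists_eval_add_two_le_pow q
  have hC : 0 < c + d + 5 := by positivity
  -- The polynomial comes from `card * p ≤ n * (1 + q(n))` and `1 / p ≤ s(n)`.
  refine ⟨c + d + 5, c + d + 5, hC, hC, fun s => ⟨s * (Polynomial.X * (1 + q)), ?_⟩⟩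
  intro n hn Ω _ μ _ ι _ A hA ε hε hε1 x h hδ
  have hQ : (0 : ℝ) ≤ (q.eval n : ℕ) := Nat.cast_nonneg _
  refine ⟨fun p hs hp => ?_, fun p hp hpn V τ hτ K hK => ?_⟩
  · have hs' : (0 : ℝ) < (s.eval n : ℕ) := by exact_mod_cast hs
    have hp0 : 0 < p := lt_of_lt_of_le (by positivity) hp
    have h1 := h.card_core_mul_le hε hε1 hQ hδ hp0
    have h2 : ((LLL.core μ A p).card : ℝ) * (1 / ((s.eval n : ℕ) : ℝ)) ≤
        n * (1 + (q.eval n : ℕ)) := (mul_le_mul_of_nonneg_left hp (Nat.cast_nonneg _)).trans h1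
    rw [mul_one_div, div_le_iff₀ hs', mul_comm] at h2
    simp only [Polynomial.eval_mul, Polynomial.eval_X, Polynomial.eval_add, Polynomial.eval_one]
    exact_mod_cast h2
  · subst hK
    refine ⟨fun ξ => LLL.moserTardos_le V hτ (LLL.resamplingBound_nonneg hC.le hn hε hε1) ξ, ?_⟩
    exact h.one_sub_rpow_le hε hε1 hA hn hQ hc (fun hn2 => by exact_mod_cast hd n hn2) hδ hp hpn V
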